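/- Let $s,d\ge 1$ be integers. For a multi-index $\alpha\in\mathbb{N}_0^d$ let $D^\alpha$ denote the mixed partial derivative of order $\alpha$ (in the weak sense where the classical one need not exist), and let $$\|f\|_{s,\mathrm{mix}}^2=\sum_{\alpha\in\mathbb{N}_0^d:\ \|\alpha\|_\infty\le s}\|D^\alpha f\|_{L_2([0,1]^d)}^2 .$$ Let $H_d^{s,\mathrm{mix}}$ be the closure in $C([0,1]^d)$, with respect to $\|\cdot\|_{s,\mathrm{mix}}$, of the set of all $f\in C^{sd}([0,1]^d)$ with $\|f\|_{s,\mathrm{mix}}\le 1$; that is, the set of all real-valued $f\in C([0,1]^d)$ that have weak derivatives $D^\alpha f\in L_2([0,1]^d)$ for all $\|\alpha\|_\infty\le s$ and are limits in $\|\cdot\|_{s,\mathrm{mix}}$ of such smooth functions. Then there exist a constant $C_{s,d}>0$, depending only on $s$ and $d$, and a sequence $(Q_n)_{n\ge 1}$ of cubature formulas $$Q_n(f)=\sum_{j=1}^n a_j^{(n)} f\bigl(x^{(n),j}\bigr),\qquad a_j^{(n)}\in\mathbb{R},\quad x^{(n),j}\in[0,1]^d,$$ such that $$\sup_{f\in H_d^{s,\mathrm{mix}}}\left|\int_{[0,1]^d}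 f(x)\,dx-Q_n(f)\right|\ \le\ C_{s,d}\, n^{-s}\,(\log n)^{\frac{d-1}{2}}$$ for all integers $n\ge 2$, and also for $n=1$ when $d=1$ (where $(\log 1)^0=1$). -/

import Mathlib

open MeasureTheory
open scoped ENNReal ContDiff

noncomputable section

/-- The closed unit cube `[0,1]^d`. -/
def unitCube (d : ℕ) : Set (Fin d → ℝ) := Set.Icc 0 1

/-- The open unit cube `(0,1)^d`. -/
def openUnitCube (d : ℕ) : Set (Fin d → ℝ) := Set.univ.pi fun _ => Set.Ioo 0 1

/-- Lebesgue measure on the unit cube. -/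
def cubeMeasure (d : ℕ) : Measure (Fin d → ℝ) := volume.restrict (unitCube d)

/-- The usual partial derivative in the direction of the `i`-th coordinate. -/
def partialD {d : ℕ} (i : Fin d) (f : (Fin d → ℝ) → ℝ) : (Fin d → ℝ) → ℝ :=
  fun x => lineDeriv ℝ f x (Pi.single i 1)

/-- The usual mixed partial derivative `D^α f` of order `α`. For a function on the closed cube only
its values at interior points are used (the boundary of the cube is a null set), so that the values
of `f` outside the cube play no role. -/
def mixedD {d : ℕ} (α : Fin d → ℕ) (f : (Fin d → ℝ) → ℝ) : (Fin d → ℝ) → ℝ :=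
  (List.finRange d).foldr (fun i g => (partialD i)^[α i] g) f

/-- `g` is a weak (distributional) derivative of order `α` of `f` on the open unit cube, and `g` is
square integrable. -/
def IsWeakMixedD {d : ℕ} (α : Fin d → ℕ) (f g : (Fin d → ℝ) → ℝ) : Prop :=
  MemLp g 2 (cubeMeasure d) ∧
    ∀ φ : (Fin d → ℝ) → ℝ, ContDiff ℝ ∞ φ → HasCompactSupport φ → tsupport φ ⊆ openUnitCube d →
      ∫ x, f x * mixedD α φ x ∂(cubeMeasure d) =
        (-1) ^ (∑ i, α i) * ∫ x, g x * φ x ∂(cubeMeasure d)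

/-- `(∑_{α : ‖α‖_∞ ≤ s} ‖F α‖_{L₂([0,1]^d)}²)^{1/2}` for a family `F` indexed by multi-indices. -/
def mixNormOfFamily {d : ℕ} (s : ℕ) (F : (Fin d → ℕ) → (Fin d → ℝ) → ℝ) : ℝ≥0∞ :=
  (∑ α ∈ Finset.Iic (fun _ : Fin d => s), eLpNorm (F α) 2 (cubeMeasure d) ^ 2) ^ (1 / 2 : ℝ)

/-- The norm `‖f‖_{s,mix}` of a function that is `s * d` times continuously differentiable. -/
def mixNorm {d : ℕ} (s : ℕ) (f : (Fin d → ℝ) → ℝ) : ℝ≥0∞ :=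
  mixNormOfFamily s fun α => mixedD α f

/-- The functions in `C^{sd}([0,1]^d)` with `‖f‖_{s,mix} ≤ 1`. -/
def smoothMixBall (d s : ℕ) : Set ((Fin d → ℝ) → ℝ) :=
  {f | ContDiffOn ℝ ((s * d : ℕ) : WithTop ℕ∞) f (unitCube d) ∧ mixNorm s f ≤ 1}

/-- The class `H_d^{s,mix}`: the closure in `C([0,1]^d)`, with respect to `‖·‖_{s,mix}`, of
`smoothMixBall d s`. Here `F α` is the weak derivative `D^α f`, which is unique almost everywhere
in the cube, so that the last norm is `‖f - g‖_{s,mix}`.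
A function on the cube is represented by any function on `ℝ^d` that extends it. -/
def mixClass (d s : ℕ) : Set ((Fin d → ℝ) → ℝ) :=
  {f | ContinuousOn f (unitCube d) ∧
    ∃ F : (Fin d → ℕ) → (Fin d → ℝ) → ℝ,
      (∀ α ∈ Finset.Iic (fun _ : Fin d => s), IsWeakMixedD α f (F α)) ∧
      ∀ ε : ℝ≥0∞, 0 < ε → ∃ g ∈ smoothMixBall d s,
        mixNormOfFamily s (fun α x => F α x - mixedD α g x) < ε}

/-- A cubature formula on `[0,1]^d` with `n` nodes (not necessarily distinct) in the cube and `n`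
real weights. -/
structure Cubature (d n : ℕ) where
  node : Fin n → Fin d → ℝ
  node_mem : ∀ j, node j ∈ unitCube d
  weight : Fin n → ℝ

/-- `Q_n(f) = ∑_j a_j f(x^j)`. -/
def Cubature.apply {d n : ℕ} (Q : Cubature d n) (f : (Fin d → ℝ) → ℝ) : ℝ :=
  ∑ j, Q.weight j * f (Q.node j)

/-- The worst case error `e(Q,H) = sup_{f ∈ H} |I(f) - Q(f)|`, as an element of `[0,∞]`. -/
def Cubature.worstCaseError {d n : ℕ} (Q : Cubature d n) (H : Set ((Fin d → ℝ) → ℝ)) : ℝ≥0∞ :=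
  ⨆ f ∈ H, ENNReal.ofReal |(∫ x, f x ∂(cubeMeasure d)) - Q.apply f|

end

/-! The formulas are Frolov's: lattice rules applied after a change of variables that flattens the
integrand at the boundary of the cube.

Suppose `h` has compact support in the cube and square integrable mixed derivatives up to order `s`
in each variable. For the lattice `M ℤ^d`, Poisson summation writes the error of `|det M| ∑ h(M m)`
as the sum of the Fourier coefficients of `h ∘ M` over the nonzero frequencies. Cauchy-Schwarz with
the weight `mixWeight s` at the dual points splits this into two factors
(`sq_tsum_sub_integral_le`). One is the sum of the weighted squared coefficients. Bessel's
inequality bounds it by the mixed norm of `h`, times the number of overlapping integer translates of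
the support (`sum_mixWeight_intFourier_le`). The other is the sum of the inverse weights over the
nonzero dual points and depends only on the lattice.

The dual lattice is `R B ℤ^d`, where every nonzero point of `B ℤ^d` has a product of coordinates at
least 1 in absolute value (`exists_admissible_matrix`; the entries are powers of the conjugates of a
totally real algebraic integer). A dyadic box of volume below about `R^d` then contains no nonzero
dual point, and a larger box contains a number of them proportional to volume over `R^d`. Summing
over boxes gives `R^(-2sd) (1 + log R)^(d-1)` (`exists_tsum_inv_mixWeight_le`), the power of the
logarithm coming from the number of boxes of given volume. About `R^d` nodes lie in the cube, so `n
~ R^d` and a square root give the rate.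

Functions in the class need not vanish at the boundary, so `f` is replaced by `f ∘ Ψ` times the
Jacobian of `Ψ`, which has the same integral. The one-dimensional density is `κ η^(2s)`. After `s`
derivatives a factor `η^s` is left, and its square is again at most a constant times the density,
hence is absorbed by changing variables back in the `L₂` norm. So the substitution is bounded in the
mixed norm (`exists_sum_integral_mixedD_sq_le`). This is shown for smooth functions with `Ψ`
contracted by `r < 1`; the limits `r → 1` and `g → f` in `L₁` are taken in finitely many Fourier
coefficients (`exists_sum_mixWeight_term_le`). -/

/-! ### An admissible lattice from a totally real polynomial -/

open Polynomial in
/-- A divisor of positive degree of `∏ (X - a j) - 1`, where the integers `a j` are distinct, has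
full degree. -/
lemma natDegree_of_mul_eq_prod_sub_one {d : ℕ} (a : Fin d → ℤ) (ha : Function.Injective a)
    {g h : ℤ[X]} (hg : g.Monic) (hh : h.Monic) (hg1 : 0 < g.natDegree)
    (hgh : ∏ j, (X - C (a j)) - 1 = g * h) : d ≤ g.natDegree := by
  by_contra! hlt
  have hev : ∀ j, g.eval (a j) * h.eval (a j) = -1 := by
    intro j
    rw [← eval_mul, ← hgh]
    simp [eval_prod, Finset.prod_eq_zero (Finset.mem_univ j)]
  -- Two integers with product -1 are 1 and -1 in some order, so `g + h` has `d` distinct zeros.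
  -- Both degrees are below `d`, since they are positive and add up to `d` under the assumption, so
  -- `g + h` vanishes, which is impossible for two monic polynomials.
  have hsum : ∀ j, (g + h).eval (a j) = 0 := by
    intro j
    have h1 := Int.eq_one_or_neg_one_of_mul_eq_neg_one (hev j)
    have h2 := hev j
    rw [eval_add]
    rcases h1 with h1 | h1 <;> rw [h1] at h2 ⊢ <;> linarith
  have hdeg : g.natDegree + h.natDegree = d := by
    rw [← hg.natDegree_mul hh, ← hgh]
    have hd1 : 1 ≤ d := by omega
    have : (∏ j, (X - C (a j)) : ℤ[X]).natDegree = d := by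
      rw [natDegree_prod_of_monic _ _ fun i _ => monic_X_sub_C (a i)]
      simp only [natDegree_X_sub_C, Finset.sum_const, Finset.card_univ, Fintype.card_fin,
        smul_eq_mul, mul_one]
    rw [natDegree_sub_eq_left_of_natDegree_lt, this]
    rw [natDegree_one, this]
    exact hd1
  have hz : g + h = 0 := by
    apply eq_zero_of_natDegree_lt_card_of_eval_eq_zero (g + h) ha hsum
    refine (natDegree_add_le _ _).trans_lt ?_
    simp only [Fintype.card_fin]
    exact max_lt hlt (by omega)
  have : h = -g := by linear_combination hz
  rw [this, Monic, leadingCoeff_neg, hg.leadingCoeff] at hh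
  omega

open Polynomial in
/-- The polynomial `∏ (X - 4 j) - 1` has a real root between `4 j - 2` and `4 j + 2`. -/
lemma exists_root_prod_sub_one {d : ℕ} (j : Fin d) :
    ∃ x ∈ Set.Ioo (4 * (j : ℝ) - 2) (4 * (j : ℝ) + 2), ∏ i : Fin d, (x - 4 * (i : ℝ)) - 1 = 0 := by
  set p : ℝ → ℝ := fun x => ∏ i : Fin d, (x - 4 * (i : ℝ)) with hp
  have hcont : Continuous fun x => p x - 1 := by fun_prop
  have habs : ∀ x : ℝ, (∀ i : Fin d, 2 ≤ |x - 4 * (i : ℝ)|) → 2 ≤ |p x| := by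
    intro x hx
    rw [hp, Finset.abs_prod, ← Finset.mul_prod_erase _ _ (Finset.mem_univ j)]
    have : 1 ≤ ∏ i ∈ Finset.univ.erase j, |x - 4 * (i : ℝ)| := by
      rw [← Finset.prod_const_one (s := Finset.univ.erase j)]
      exact Finset.prod_le_prod (fun _ _ => zero_le_one) fun i _ => by linarith [hx i]
    nlinarith [hx j]
  -- The points `4 j ± 2` lie midway between consecutive multiples of 4, hence at distance at least
  -- 2 from each of them.
  have hint : ∀ m : ℤ, 2 ≤ |4 * (m : ℝ) + 2| := by
    intro m
    have : 2 ≤ |4 * m + 2| := by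
      rcases le_total 0 m with h | h
      · rw [abs_of_nonneg] <;> omega
      · rw [le_abs]; omega
    exact_mod_cast this
  have h1 : 2 ≤ |p (4 * j - 2)| := by
    apply habs
    intro i
    have := hint ((j : ℤ) - i - 1)
    push_cast at this
    convert this using 2; ring
  have h2 : 2 ≤ |p (4 * j + 2)| := by
    apply habs
    intro i
    have := hint ((j : ℤ) - i)
    push_cast at this
    convert this using 2; ring
  -- Pairing factors gives `∏ (16 (j - i)^2 - 4)`. Only the factor with `i = j` is negative, so `p`
  -- changes sign; since `|p| ≥ 2` at both ends, it crosses the value 1 as well.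
  have hneg : p (4 * j - 2) * p (4 * j + 2) < 0 := by
    rw [hp, ← Finset.prod_mul_distrib, ← Finset.mul_prod_erase _ _ (Finset.mem_univ j)]
    apply mul_neg_of_neg_of_pos
    · nlinarith
    · apply Finset.prod_pos
      intro i hi
      have hne : ((j : ℤ) - i) ≠ 0 := by
        have := Finset.ne_of_mem_erase hi
        intro h
        apply this
        ext
        omega
      have hsq : 1 ≤ ((j : ℤ) - i) ^ 2 := by
        have := sq_pos_of_ne_zero hne
        omega
      have : (1 : ℝ) ≤ ((j : ℝ) - i) ^ 2 := by exact_mod_cast hsq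
      nlinarith
  have hab : 4 * (j : ℝ) - 2 ≤ 4 * j + 2 := by linarith
  rcases le_or_gt 0 (p (4 * j - 2)) with h0 | h0
  · have h3 : p (4 * j + 2) < 0 := by
      by_contra! h
      nlinarith
    rw [abs_of_nonneg h0] at h1
    exact intermediate_value_Ioo' hab hcont.continuousOn ⟨by linarith, by linarith⟩
  · have h3 : 0 < p (4 * j + 2) := by
      by_contra! h
      nlinarith
    rw [abs_of_pos h3] at h2
    exact intermediate_value_Ioo hab hcont.continuousOn ⟨by linarith, by linarith⟩

open Polynomial in
/-- There is a lattice `B ℤ^d` all of whose nonzero points have a norm form that is at least `1`. -/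
theorem exists_admissible_matrix (d : ℕ) (hd : 1 ≤ d) :
    ∃ B : Matrix (Fin d) (Fin d) ℝ, B.det ≠ 0 ∧
      ∀ k : Fin d → ℤ, k ≠ 0 → 1 ≤ |∏ j, (B.mulVec fun i => (k i : ℝ)) j| := by
  choose ζ hζ hroot using fun j : Fin d => exists_root_prod_sub_one j
  have hinj : Function.Injective ζ := by
    intro i j hij
    have h1 := hζ i
    have h2 := hζ j
    rw [hij] at h1
    by_contra hne
    have hne' : (i : ℕ) ≠ j := fun h => hne (Fin.ext h)
    rcases lt_or_gt_of_ne hne' with h | h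
    · have : (i : ℝ) + 1 ≤ j := by exact_mod_cast h
      linarith [h1.2, h2.1]
    · have : (j : ℝ) + 1 ≤ i := by exact_mod_cast h
      linarith [h1.1, h2.2]
  set f : ℤ[X] := ∏ j : Fin d, (X - C (4 * (j : ℤ))) - 1 with hf
  have hp : (∏ j : Fin d, (X - C (4 * (j : ℤ))) : ℤ[X]).Monic :=
    monic_prod_of_monic _ _ fun i _ => monic_X_sub_C _
  have hpd : (∏ j : Fin d, (X - C (4 * (j : ℤ))) : ℤ[X]).natDegree = d := by
    rw [natDegree_prod_of_monic _ _ fun i _ => monic_X_sub_C _]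
    simp only [natDegree_X_sub_C, Finset.sum_const, Finset.card_univ, Fintype.card_fin,
      smul_eq_mul, mul_one]
  have hfd : f.natDegree = d := by
    rw [hf, natDegree_sub_eq_left_of_natDegree_lt, hpd]
    rw [natDegree_one, hpd]
    exact hd
  have hfm : f.Monic := by
    apply hp.sub_of_left
    rw [degree_one, ← natDegree_pos_iff_degree_pos, hpd]
    exact hd
  have hfeval : ∀ j, aeval (ζ j) f = 0 := by
    intro j
    have := hroot j
    simp only [hf, map_sub, map_prod, aeval_X, aeval_C, map_one]
    simpa using this
  have ha : Function.Injective fun j : Fin d => 4 * (j : ℤ) := by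
    intro i j h
    ext
    simp only at h
    omega
  -- This is the irreducibility of `f`: the minimal polynomial of `ζ j` is a monic divisor of
  -- positive degree, hence has degree at least `d`.
  have hne : ∀ (P : ℤ[X]) (j : Fin d), P ≠ 0 → P.natDegree < d → aeval (ζ j) P ≠ 0 := by
    intro P j hP hPd h0
    have hζint : IsIntegral ℤ (ζ j) := ⟨f, hfm, hfeval j⟩
    obtain ⟨h, hh⟩ := minpoly.isIntegrallyClosed_dvd hζint (hfeval j)
    have hm := minpoly.monic hζint
    have hhm : h.Monic := hm.of_mul_monic_left (hh ▸ hfm)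
    have h1 := natDegree_of_mul_eq_prod_sub_one _ ha hm hhm (minpoly.natDegree_pos hζint) hh
    have h2 := natDegree_le_of_dvd (minpoly.isIntegrallyClosed_dvd hζint h0) hP
    omega
  have hprod : f.map (algebraMap ℤ ℝ) = ∏ j, (X - C (ζ j)) := by
    have hm : (∏ j, (X - C (ζ j))).Monic := monic_prod_of_monic _ _ fun i _ => monic_X_sub_C _
    apply eq_of_monic_of_dvd_of_natDegree_le hm (hfm.map _)
    · apply Finset.prod_dvd_of_coprime
      · intro i _ j _ hij
        exact isCoprime_X_sub_C_of_isUnit_sub (sub_ne_zero.2 (hinj.ne hij)).isUnit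
      · intro i _
        rw [dvd_iff_isRoot, IsRoot.def, eval_map_algebraMap]
        exact hfeval i
    · rw [hfm.natDegree_map, hfd, natDegree_prod_of_monic _ _ fun i _ => monic_X_sub_C _]
      simp
  refine ⟨Matrix.vandermonde ζ, (Matrix.det_vandermonde_ne_zero_iff).2 hinj, ?_⟩
  intro k hk
  set P : ℤ[X] := ∑ i : Fin d, C (k i) * X ^ (i : ℕ) with hPdef
  have hcoeff : ∀ i : Fin d, P.coeff i = k i := by
    intro i
    simp only [hPdef, finsetSum_coeff, coeff_C_mul, coeff_X_pow]
    rw [Finset.sum_eq_single i]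
    · simp
    · intro b _ hb
      have : (i : ℕ) ≠ b := fun h => hb (Fin.ext h.symm)
      simp [this]
    · simp
  have hP0 : P ≠ 0 := by
    intro h
    apply hk
    ext i
    rw [← hcoeff i, h]
    simp
  have hPd : P.natDegree < d := by
    have : P.natDegree ≤ d - 1 := by
      apply natDegree_sum_le_of_forall_le
      intro i _
      refine (natDegree_C_mul_X_pow_le _ _).trans ?_
      omega
    omega
  have hmul : ∀ j, ((Matrix.vandermonde ζ).mulVec fun i => (k i : ℝ)) j = aeval (ζ j) P := by
    intro j
    simp [Matrix.mulVec, dotProduct, Matrix.vandermonde, hPdef, mul_comm]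
  -- The norm form at `k` is `∏ P(ζ j)`, the resultant of the monic `f` with `P`. It is therefore an
  -- integer, and a nonzero one has absolute value at least 1.
  have hres : ((resultant f P f.natDegree P.natDegree : ℤ) : ℝ) = ∏ j, aeval (ζ j) P := by
    have h1 := resultant_map_map f P f.natDegree P.natDegree (algebraMap ℤ ℝ)
    have h2 := resultant_eq_prod_eval (f.map (algebraMap ℤ ℝ)) (P.map (algebraMap ℤ ℝ)) P.natDegree
      natDegree_map_le (by
        rw [hprod]
        exact Splits.prod fun i _ => Splits.X_sub_C _)
    rw [hfm.natDegree_map] at h2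
    rw [h1] at h2
    have hroots : (∏ j, (X - C (ζ j))).roots = Finset.univ.val.map ζ := by
      rw [← roots_multiset_prod_X_sub_C (Finset.univ.val.map ζ), Multiset.map_map]
      rfl
    have hm : (∏ j, (X - C (ζ j))).Monic := monic_prod_of_monic _ _ fun i _ => monic_X_sub_C _
    rw [hprod, hroots, hm.leadingCoeff, one_pow, one_mul, Multiset.map_map] at h2
    refine h2.trans ?_
    exact Finset.prod_congr (s₁ := Finset.univ) rfl fun j _ => eval_map_algebraMap P (ζ j)
  have hne0 : resultant f P f.natDegree P.natDegree ≠ 0 := by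
    intro h
    rw [h, Int.cast_zero] at hres
    obtain ⟨j, _, hj⟩ := Finset.prod_eq_zero_iff.1 hres.symm
    exact hne P j hP0 hPd hj
  simp only [hmul]
  rw [← hres]
  exact_mod_cast Int.one_le_abs hne0

/-! ### Sums of inverse weights over the dual lattice -/

/-- The product weight `∏ max(1, |ξ_j|)^(2 s)` on frequencies. -/
noncomputable def mixWeight {d : ℕ} (s : ℕ) (ξ : Fin d → ℝ) : ℝ := ∏ j, max 1 |ξ j| ^ (2 * s)

lemma one_le_mixWeight {d : ℕ} (s : ℕ) (ξ : Fin d → ℝ) : 1 ≤ mixWeight s ξ := by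
  calc (1 : ℝ) = ∏ _j : Fin d, 1 := Finset.prod_const_one.symm
    _ ≤ _ := Finset.prod_le_prod (fun _ _ => zero_le_one) fun i _ => one_le_pow₀ (le_max_left _ _)

lemma mixWeight_pos {d : ℕ} (s : ℕ) (ξ : Fin d → ℝ) : 0 < mixWeight s ξ :=
  zero_lt_one.trans_le (one_le_mixWeight s ξ)

/-- There are at most `(m + 1)^e` vectors in `ℕ^(e + 1)` with sum `m`. -/
lemma card_piAntidiag_le (e m : ℕ) :
    (Finset.piAntidiag (Finset.univ : Finset (Fin (e + 1))) m).card ≤ (m + 1) ^ e := by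
  have h : (m + 1) ^ e = (Fintype.piFinset fun _ : Fin e => Finset.range (m + 1)).card := by simp
  rw [h]
  apply Finset.card_le_card_of_injOn Fin.tail
  · intro l hl
    simp only [Finset.mem_coe, Finset.mem_piAntidiag] at hl
    simp only [Finset.mem_coe, Fintype.mem_piFinset, Finset.mem_range]
    intro i
    have : l i.succ ≤ ∑ j, l j :=
      Finset.single_le_sum (fun _ _ => Nat.zero_le _) (Finset.mem_univ _)
    have h2 : ∑ j, l j = m := hl.1
    simp only [Fin.tail]
    omega
  · intro l hl l' hl' hll
    simp only [Finset.mem_coe, Finset.mem_piAntidiag] at hl hl'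
    have h1 := hl.1
    have h2 := hl'.1
    rw [Fin.sum_univ_succ] at h1 h2
    have h3 : ∀ i : Fin e, l i.succ = l' i.succ := fun i => congrFun hll i
    simp only [h3] at h1
    ext i
    refine Fin.cases ?_ (fun i => h3 i) i
    omega

/-- Summation over `ℕ^(e + 1)` of a function of the sum of the coordinates. -/
lemma tsum_sum_le (e : ℕ) (g : ℕ → ℝ≥0∞) :
    ∑' l : Fin (e + 1) → ℕ, g (∑ j, l j) ≤ ∑' m : ℕ, ((m : ℝ≥0∞) + 1) ^ e * g m := by
  have h1 : ∀ l : Fin (e + 1) → ℕ,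
      g (∑ j, l j) = ∑' m : ℕ, if l ∈ Finset.piAntidiag Finset.univ m then g m else 0 := by
    intro l
    rw [tsum_eq_single (∑ j, l j)]
    · simp
    · intro m hm
      rw [if_neg]
      simp only [Finset.mem_piAntidiag, not_and_or]
      exact Or.inl fun h => hm h.symm
  simp only [h1]
  rw [ENNReal.tsum_comm]
  apply ENNReal.tsum_le_tsum
  intro m
  rw [tsum_eq_sum (s := Finset.piAntidiag Finset.univ m) (fun l hl => if_neg hl)]
  rw [Finset.sum_congr rfl fun l hl => if_pos hl, Finset.sum_const, nsmul_eq_mul]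
  gcongr
  exact_mod_cast card_piAntidiag_le e m

lemma tsum_pow_mul_geometric_ne_top (e : ℕ) :
    ∑' m : ℕ, ((m : ℝ≥0∞) + 1) ^ e * 2⁻¹ ^ m ≠ ⊤ := by
  have h1 : Summable fun m : ℕ => ((m : ℝ) + 1) ^ e * (2⁻¹ : ℝ) ^ m := by
    have := (summable_nat_add_iff 1).2
      (summable_pow_mul_geometric_of_norm_lt_one e (r := (2⁻¹ : ℝ)) (by norm_num))
    refine (this.mul_left 2).congr fun m => ?_
    push_cast
    rw [pow_succ]
    ring
  have h2 := h1.tsum_ofReal_ne_top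
  convert! h2 using 4 with m
  rw [ENNReal.ofReal_mul (by positivity), ENNReal.ofReal_pow (by positivity),
    ENNReal.ofReal_pow (by positivity), ENNReal.ofReal_inv_of_pos (by norm_num)]
  congr
  · rw [ENNReal.ofReal_add (by positivity) (by positivity)]
    simp
  · simp

/-- The tail of `∑ 2^(-|l|)` over `ℕ^(e + 1)`. -/
lemma tsum_tail_le (e m₀ : ℕ) :
    ∑' l : Fin (e + 1) → ℕ, (if m₀ ≤ ∑ j, l j then (2⁻¹ : ℝ≥0∞) ^ (∑ j, l j) else 0) ≤
      (m₀ + 1) ^ e * 2⁻¹ ^ m₀ * ∑' m : ℕ, ((m : ℝ≥0∞) + 1) ^ e * 2⁻¹ ^ m := by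
  refine (tsum_sum_le e fun m => if m₀ ≤ m then (2⁻¹ : ℝ≥0∞) ^ m else 0).trans ?_
  have h0 : ∑ m ∈ Finset.range m₀,
      ((m : ℝ≥0∞) + 1) ^ e * (if m₀ ≤ m then (2⁻¹ : ℝ≥0∞) ^ m else 0) = 0 := by
    apply Finset.sum_eq_zero
    intro m hm
    rw [if_neg (not_le.2 (Finset.mem_range.1 hm)), mul_zero]
  have h1 := Summable.sum_add_tsum_nat_add' (k := m₀) (f := fun m : ℕ => ((m : ℝ≥0∞) + 1) ^ e *
    (if m₀ ≤ m then (2⁻¹ : ℝ≥0∞) ^ m else 0)) ENNReal.summable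
  rw [h0, zero_add] at h1
  rw [← h1, ← ENNReal.tsum_mul_left]
  apply ENNReal.tsum_le_tsum
  intro m
  rw [if_pos (by omega)]
  -- This separates `m₀` from the summation index, so that the remaining series is a constant.
  have h2 : ((m + m₀ : ℕ) : ℝ≥0∞) + 1 ≤ (m₀ + 1) * (m + 1) := by
    have : (m + m₀ : ℕ) + 1 ≤ (m₀ + 1) * (m + 1) := by nlinarith
    exact_mod_cast this
  calc (((m + m₀ : ℕ) : ℝ≥0∞) + 1) ^ e * 2⁻¹ ^ (m + m₀)
      ≤ ((m₀ + 1) * (m + 1)) ^ e * 2⁻¹ ^ (m + m₀) := by gcongr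
    _ = (m₀ + 1) ^ e * 2⁻¹ ^ m₀ * ((m + 1) ^ e * 2⁻¹ ^ m) := by
      rw [mul_pow, add_comm m, pow_add, mul_mul_mul_comm]

/-- A set of points in a box, any two of which differ by a vector of large norm form, is small. -/
lemma ncard_box_le {d : ℕ} (hd : 1 ≤ d) (φ : (Fin d → ℤ) →+ (Fin d → ℝ)) {N : ℝ} (hN : 0 < N)
    (hφ : ∀ k, k ≠ 0 → N ≤ |∏ j, φ k j|) (l : Fin d → ℕ) :
    {k | ∀ j, |φ k j| < 2 ^ l j}.Finite ∧
      ({k | ∀ j, |φ k j| < 2 ^ l j}.ncard : ℝ) ≤ 2 ^ d * 2 ^ (∑ j, l j) / N + 2 := by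
  set S := {k | ∀ j, |φ k j| < 2 ^ l j} with hS
  let i₀ : Fin d := ⟨0, hd⟩
  set q : ℝ := ∏ j ∈ Finset.univ.erase i₀, 2 ^ (l j + 1) with hq
  have hqpos : 0 < q := Finset.prod_pos fun _ _ => by positivity
  set h : ℝ := N / q with hh
  have hhpos : 0 < h := by positivity
  -- Pigeonhole: two points of the box differ by at most `2^(l j + 1)` in coordinate `j`, so the
  -- coordinates other than `i₀` contribute at most `q` to the norm form of the difference. If the
  -- coordinates at `i₀` were closer than `h = N / q`, the norm form would be below `N`.
  have hinj : Set.InjOn (fun k => ⌊φ k i₀ / h⌋) S := by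
    intro k hk k' hk' hkk
    by_contra hne
    have h1 := hφ (k - k') (sub_ne_zero.2 hne)
    have h2 : |φ (k - k') i₀| < h := by
      have := Int.abs_sub_lt_one_of_floor_eq_floor hkk
      rw [← sub_div, abs_div, abs_of_pos hhpos, div_lt_one hhpos] at this
      simpa using this
    rw [Finset.abs_prod, ← Finset.mul_prod_erase _ _ (Finset.mem_univ i₀)] at h1
    have h3 : ∏ j ∈ Finset.univ.erase i₀, |φ (k - k') j| ≤ q := by
      apply Finset.prod_le_prod (fun _ _ => abs_nonneg _)
      intro j _
      rw [map_sub, Pi.sub_apply, pow_succ]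
      have h4 := hk j
      have h5 := hk' j
      have := abs_sub (φ k j) (φ k' j)
      linarith
    have : |φ (k - k') i₀| * ∏ j ∈ Finset.univ.erase i₀, |φ (k - k') j| < N := by
      calc _ ≤ |φ (k - k') i₀| * q := by gcongr
        _ < h * q := by gcongr
        _ = N := by rw [hh]; field_simp
    linarith
  set a : ℤ := ⌊-(2 ^ l i₀ / h)⌋ with ha
  set b : ℤ := ⌊2 ^ l i₀ / h⌋ with hb
  have hmaps : Set.MapsTo (fun k => ⌊φ k i₀ / h⌋) S (Finset.Icc a b : Finset ℤ) := by
    intro k hk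
    have h1 := abs_lt.1 (hk i₀)
    simp only [Finset.coe_Icc, Set.mem_Icc, ha, hb]
    constructor
    · apply Int.floor_mono
      rw [← neg_div]
      gcongr
      exact h1.1.le
    · apply Int.floor_mono
      gcongr
      exact h1.2.le
  have hfin : S.Finite := Set.Finite.of_injOn hmaps hinj (Finset.finite_toSet _)
  refine ⟨hfin, ?_⟩
  have hc := Set.ncard_le_ncard_of_injOn _ hmaps hinj (Finset.finite_toSet _)
  rw [Set.ncard_coe_finset, Int.card_Icc] at hc
  have hvol : 2 ^ d * 2 ^ (∑ j, l j) / N = 2 * (2 ^ l i₀ / h) := by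
    have h1 : (2 : ℝ) ^ d * 2 ^ (∑ j, l j) = ∏ j, 2 ^ (l j + 1) := by
      simp only [pow_succ]
      rw [Finset.prod_mul_distrib, Finset.prod_pow_eq_pow_sum]
      simp [mul_comm]
    rw [h1, ← Finset.mul_prod_erase _ _ (Finset.mem_univ i₀), ← hq, hh]
    field_simp
    ring
  rw [hvol]
  -- The two roundings together cost less than 1, and counting both endpoints costs 1 more; this is
  -- the additive 2.
  have hfa := Int.lt_floor_add_one (-(2 ^ l i₀ / h))
  have hfb := Int.floor_le (2 ^ l i₀ / h)
  have hab : a ≤ b := by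
    apply Int.floor_mono
    have : 0 < 2 ^ l i₀ / h := by positivity
    linarith
  have hc' : (S.ncard : ℝ) ≤ (b : ℝ) + 1 - a := by
    have : (S.ncard : ℤ) ≤ b + 1 - a := by omega
    exact_mod_cast this
  rw [← ha] at hfa
  rw [← hb] at hfb
  linarith

/-- The least admissible `l` works: if it is positive, then `2^(l - 1) ≤ |x|` by minimality. -/
lemma exists_dyadic (x : ℝ) : ∃ l : ℕ, |x| < 2 ^ l ∧ (2 : ℝ) ^ l ≤ 2 * max 1 |x| := by
  have hex : ∃ l : ℕ, |x| < 2 ^ l := pow_unbounded_of_one_lt _ one_lt_two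
  classical
  refine ⟨Nat.find hex, Nat.find_spec hex, ?_⟩
  rcases Nat.eq_zero_or_pos (Nat.find hex) with h0 | h0
  · rw [h0, pow_zero]
    linarith [le_max_left 1 |x|]
  · have h1 := Nat.find_min hex (Nat.sub_lt h0 one_pos)
    have h2 : (2 : ℝ) ^ Nat.find hex = 2 * 2 ^ (Nat.find hex - 1) := by
      rw [← pow_succ', Nat.sub_add_cancel h0]
    rw [h2]
    push Not at h1
    have := le_max_right 1 |x|
    linarith

/-- The exponents come from `exists_dyadic`; its factor 2 in each of the `d` coordinates, raised to
the power `2 s`, is the constant. -/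
lemma inv_mixWeight_le {d : ℕ} (s : ℕ) (ξ : Fin d → ℝ) :
    ∃ l : Fin d → ℕ, (∀ j, |ξ j| < 2 ^ l j) ∧
      (mixWeight s ξ)⁻¹ ≤ 2 ^ (2 * s * d) * ((2 : ℝ)⁻¹ ^ (∑ j, l j)) ^ (2 * s) := by
  choose l hl hl' using fun j => exists_dyadic (ξ j)
  refine ⟨l, hl, ?_⟩
  rw [inv_le_iff_one_le_mul₀ (mixWeight_pos s ξ)]
  have h1 : (2 : ℝ) ^ (2 * s * d) * ((2 : ℝ)⁻¹ ^ (∑ j, l j)) ^ (2 * s) * mixWeight s ξ =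
      ∏ j, (2 * (2 : ℝ)⁻¹ ^ l j * max 1 |ξ j|) ^ (2 * s) := by
    simp only [mul_pow, Finset.prod_mul_distrib, mixWeight]
    congr 2
    · simp [pow_mul]
    · rw [← Finset.prod_pow_eq_pow_sum, Finset.prod_pow]
  rw [h1]
  refine (Finset.prod_const_one (s := (Finset.univ : Finset (Fin d)))).symm.trans_le ?_
  apply Finset.prod_le_prod (fun _ _ => zero_le_one)
  intro j _
  apply one_le_pow₀
  have h2 := hl' j
  have h3 : (0 : ℝ) < 2 ^ l j := by positivity
  rw [inv_pow]
  calc (1 : ℝ) = (2 ^ l j)⁻¹ * 2 ^ l j := by field_simp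
    _ ≤ (2 ^ l j)⁻¹ * (2 * max 1 |ξ j|) := by gcongr
    _ = _ := by ring

/-- Summation of a function over the nonzero points of an admissible lattice that is controlled by
boxes. -/
lemma tsum_inv_mixWeight_le_tsum {e s : ℕ} (hs : 1 ≤ s)
    (φ : (Fin (e + 1) → ℤ) →+ (Fin (e + 1) → ℝ)) {N : ℝ} (hN : 1 ≤ N)
    (hφ : ∀ k, k ≠ 0 → N ≤ |∏ j, φ k j|) :
    ∑' k, (if k = 0 then 0 else ENNReal.ofReal (mixWeight s (φ k))⁻¹) ≤
      ENNReal.ofReal (2 ^ (2 * s * (e + 1)) * (2 ^ (e + 1) + 2) * (N ^ (2 * s - 1))⁻¹) *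
        ∑' l : Fin (e + 1) → ℕ,
          if N ≤ 2 ^ (∑ j, l j) then (2⁻¹ : ℝ≥0∞) ^ (∑ j, l j) else 0 := by
  have hNpos : 0 < N := by linarith
  set c : ℝ := 2 ^ (2 * s * (e + 1)) with hc
  set S : (Fin (e + 1) → ℕ) → Set (Fin (e + 1) → ℤ) :=
    fun l => {k | k ≠ 0 ∧ ∀ j, |φ k j| < 2 ^ l j} with hS
  classical
  -- Each nonzero `k` is charged to one dyadic box containing it. Summing over all boxes that
  -- contain it only overcounts.
  have h1 : ∀ k, (if k = 0 then 0 else ENNReal.ofReal (mixWeight s (φ k))⁻¹) ≤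
      ∑' l : Fin (e + 1) → ℕ, (S l).indicator
        (fun _ => ENNReal.ofReal (c * ((2 : ℝ)⁻¹ ^ (∑ j, l j)) ^ (2 * s))) k := by
    intro k
    split_ifs with hk
    · exact zero_le
    obtain ⟨l, hl, hl'⟩ := inv_mixWeight_le s (φ k)
    refine le_trans ?_ (ENNReal.le_tsum l)
    rw [Set.indicator_of_mem (show k ∈ S l from ⟨hk, hl⟩)]
    exact ENNReal.ofReal_le_ofReal hl'
  refine (ENNReal.tsum_le_tsum h1).trans ?_
  rw [ENNReal.tsum_comm, ← ENNReal.tsum_mul_left]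
  apply ENNReal.tsum_le_tsum
  intro l
  set m := ∑ j, l j with hm
  split_ifs with hNm
  · obtain ⟨hfin, hcard⟩ := ncard_box_le (Nat.le_add_left 1 e) φ hNpos hφ l
    have hfinS : (S l).Finite := hfin.subset fun k hk => hk.2
    have hcardS : ((S l).ncard : ℝ) ≤ (2 ^ (e + 1) + 2) * (2 ^ m / N) := by
      have h2 : ((S l).ncard : ℝ) ≤ ({k | ∀ j, |φ k j| < 2 ^ l j}.ncard : ℝ) := by
        exact_mod_cast Set.ncard_le_ncard (fun k (hk : k ∈ S l) => hk.2) hfin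
      -- For the boxes that matter the main term is at least 1, so it absorbs the additive 2 of the
      -- count.
      have h3 : 1 ≤ 2 ^ m / N := (one_le_div hNpos).2 hNm
      calc ((S l).ncard : ℝ) ≤ 2 ^ (e + 1) * 2 ^ m / N + 2 := h2.trans hcard
        _ ≤ 2 ^ (e + 1) * 2 ^ m / N + 2 * (2 ^ m / N) := by linarith
        _ = _ := by ring
    rw [tsum_eq_sum (s := hfinS.toFinset) (fun k hk =>
       Set.indicator_of_notMem (by simpa using hk) _)]
    rw [Finset.sum_congr rfl fun k hk => Set.indicator_of_mem (hfinS.mem_toFinset.1 hk) _,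
      Finset.sum_const, nsmul_eq_mul, ← Set.ncard_eq_toFinset_card _ hfinS]
    have h4 : (2⁻¹ : ℝ≥0∞) ^ m = ENNReal.ofReal ((2 : ℝ)⁻¹ ^ m) := by
      rw [ENNReal.ofReal_pow (by positivity), ENNReal.ofReal_inv_of_pos (by norm_num)]
      simp
    rw [h4, ← ENNReal.ofReal_natCast, ← ENNReal.ofReal_mul (by positivity),
      ← ENNReal.ofReal_mul (by positivity)]
    apply ENNReal.ofReal_le_ofReal
    have h5 : (2 : ℝ) ^ m * (2⁻¹ : ℝ) ^ m = 1 := by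
      rw [← mul_pow]; norm_num
    have h6 : ((2 : ℝ)⁻¹ ^ m) ≤ N⁻¹ := by
      rw [inv_pow]
      gcongr
    have h7 : 2 * s = 2 * s - 2 + 1 + 1 := by omega
    have h8 : 2 * s - 1 = 2 * s - 2 + 1 := by omega
    have h9 : ((2 : ℝ)⁻¹ ^ m) ^ (2 * s - 2) ≤ N⁻¹ ^ (2 * s - 2) := by gcongr
    -- Of the `2 s` factors `2^(-m)`, one cancels the count, one is kept for the summation over
    -- boxes, and the other `2 s - 2` are bounded by `1 / N` each.
    calc ((S l).ncard : ℝ) * (c * ((2 : ℝ)⁻¹ ^ m) ^ (2 * s))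
        ≤ (2 ^ (e + 1) + 2) * (2 ^ m / N) * (c * ((2 : ℝ)⁻¹ ^ m) ^ (2 * s)) := by gcongr
      _ = (2 ^ (e + 1) + 2) * (c / N) * (((2 : ℝ)⁻¹ ^ m) ^ (2 * s - 2) *
          (2 ^ m * (2⁻¹ : ℝ) ^ m) * (2 : ℝ)⁻¹ ^ m) := by
        nth_rewrite 1 [h7]
        rw [pow_succ ((2 : ℝ)⁻¹ ^ m), pow_succ ((2 : ℝ)⁻¹ ^ m)]
        ring
      _ ≤ (2 ^ (e + 1) + 2) * (c / N) * (N⁻¹ ^ (2 * s - 2) * 1 * (2 : ℝ)⁻¹ ^ m) := by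
        rw [h5]
        gcongr
      _ = _ := by
        rw [h8, pow_succ N, inv_pow, mul_inv]
        ring
  -- A box with `2^m < N` contains no nonzero lattice point, because the norm form inside it is at
  -- most `2^m`.
  · rw [mul_zero, nonpos_iff_eq_zero, ENNReal.tsum_eq_zero]
    intro k
    apply Set.indicator_of_notMem
    rintro ⟨hk0, hk⟩
    apply hNm
    refine (hφ k hk0).trans ?_
    rw [Finset.abs_prod, hm, ← Finset.prod_pow_eq_pow_sum]
    exact Finset.prod_le_prod (fun _ _ => abs_nonneg _) fun j _ => (hk j).le

/-- The sum of the inverse weights over the nonzero points of the dual lattice `R B ℤ^d`. -/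
theorem exists_tsum_inv_mixWeight_le {d s : ℕ} (hd : 1 ≤ d) (hs : 1 ≤ s)
    (B : Matrix (Fin d) (Fin d) ℝ)
    (hB : ∀ k : Fin d → ℤ, k ≠ 0 → 1 ≤ |∏ j, (B.mulVec fun i => (k i : ℝ)) j|) :
    ∃ C : ℝ, 0 < C ∧ ∀ R : ℝ, 1 ≤ R →
      ∑' k : Fin d → ℤ, (if k = 0 then 0 else
        ENNReal.ofReal (mixWeight s (R • B.mulVec fun i => (k i : ℝ)))⁻¹) ≤
      ENNReal.ofReal (C * (R ^ (2 * s * d))⁻¹ * (1 + Real.log R) ^ (d - 1)) := by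
  obtain ⟨e, rfl⟩ : ∃ e, d = e + 1 := ⟨d - 1, by omega⟩
  set K := ∑' m : ℕ, ((m : ℝ≥0∞) + 1) ^ e * 2⁻¹ ^ m with hK
  have hKtop : K ≠ ⊤ := tsum_pow_mul_geometric_ne_top e
  set c : ℝ := 2 ^ (2 * s * (e + 1)) * (2 ^ (e + 1) + 2) with hc
  have hcpos : 0 < c := by positivity
  refine ⟨c * (2 * (e + 1)) ^ e * (K.toReal + 1), by positivity, ?_⟩
  intro R hR
  let φ : (Fin (e + 1) → ℤ) →+ (Fin (e + 1) → ℝ) :=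
    { toFun := fun k => R • B.mulVec fun i => (k i : ℝ)
      map_zero' := by
        simp only [Pi.zero_apply, Int.cast_zero]
        rw [show (fun _ : Fin (e + 1) => (0 : ℝ)) = 0 from rfl, Matrix.mulVec_zero, smul_zero]
      map_add' := by
        intro x y
        rw [← smul_add, ← Matrix.mulVec_add]
        congr 2
        ext i
        simp }
  have hRpos : 0 < R := by linarith
  set N := R ^ (e + 1) with hN
  have hN1 : 1 ≤ N := one_le_pow₀ hR
  have hNpos : 0 < N := by linarith
  have hφ : ∀ k, k ≠ 0 → N ≤ |∏ j, φ k j| := by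
    intro k hk
    have h1 : ∏ j, φ k j = N * ∏ j, (B.mulVec fun i => (k i : ℝ)) j := by
      simp only [φ, AddMonoidHom.coe_mk, ZeroHom.coe_mk, Pi.smul_apply, smul_eq_mul,
        Finset.prod_mul_distrib, Finset.prod_const, Finset.card_univ, Fintype.card_fin, hN]
    rw [h1, abs_mul, abs_of_pos hNpos]
    exact le_mul_of_one_le_right hNpos.le (hB k hk)
  refine (tsum_inv_mixWeight_le_tsum hs φ hN1 hφ).trans ?_
  have hex : ∃ m : ℕ, N ≤ 2 ^ m := (pow_unbounded_of_one_lt _ one_lt_two).imp fun _ h => h.le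
  classical
  set m₀ := Nat.find hex with hm₀
  have hm₀N : N ≤ 2 ^ m₀ := Nat.find_spec hex
  have hiff : ∀ m : ℕ, N ≤ 2 ^ m ↔ m₀ ≤ m := by
    intro m
    refine ⟨fun h => Nat.find_min' hex h, fun h => hm₀N.trans ?_⟩
    exact pow_le_pow_right₀ one_le_two h
  have hlogR : 0 ≤ Real.log R := Real.log_nonneg hR
  -- Minimality gives `(m₀ - 1) log 2 < (e + 1) log R`, and `log 2 > 1/2`.
  have hm₀log : (m₀ : ℝ) + 1 ≤ 2 * (e + 1) * (1 + Real.log R) := by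
    have hlogN : Real.log N = (e + 1) * Real.log R := by
      rw [hN, Real.log_pow]; push_cast; ring
    rcases Nat.eq_zero_or_pos m₀ with h0 | h0
    · rw [h0]
      push_cast
      have : (0 : ℝ) ≤ e := by positivity
      nlinarith
    · have h1 := Nat.find_min hex (Nat.sub_lt h0 one_pos)
      push Not at h1
      have h2 := Real.log_lt_log (by positivity) h1
      rw [Real.log_pow, hlogN, ← hm₀, Nat.cast_sub (Nat.one_le_of_lt h0)] at h2
      have h3 := Real.log_two_gt_d9
      have h4 : (1 : ℝ) ≤ m₀ := by exact_mod_cast h0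
      push_cast at h2
      have : (0 : ℝ) ≤ e := by positivity
      have h5 : ((m₀ : ℝ) - 1) * (1 / 2) ≤ (m₀ - 1) * Real.log 2 := by
        gcongr
        · linarith
      nlinarith
  simp only [hiff]
  refine (mul_le_mul_right (tsum_tail_le e m₀) _).trans ?_
  have h4 : ((m₀ : ℝ≥0∞) + 1) ^ e * (2⁻¹ : ℝ≥0∞) ^ m₀ * K =
      ENNReal.ofReal (((m₀ : ℝ) + 1) ^ e * (2 : ℝ)⁻¹ ^ m₀ * K.toReal) := by
    rw [ENNReal.ofReal_mul (by positivity), ENNReal.ofReal_mul (by positivity),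
      ENNReal.ofReal_toReal hKtop, ENNReal.ofReal_pow (by positivity),
      ENNReal.ofReal_pow (by positivity), ENNReal.ofReal_inv_of_pos (by norm_num),
      ENNReal.ofReal_add (by positivity) (by positivity)]
    simp
  rw [h4, ← ENNReal.ofReal_mul (by positivity)]
  apply ENNReal.ofReal_le_ofReal
  have h5 : (2 : ℝ)⁻¹ ^ m₀ ≤ N⁻¹ := by
    rw [inv_pow]
    gcongr
  have h6 : R ^ (2 * s * (e + 1)) = N ^ (2 * s - 1) * N := by
    rw [← pow_succ, Nat.sub_add_cancel (by omega), hN, ← pow_mul]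
    ring_nf
  rw [Nat.add_sub_cancel, h6]
  calc c * (N ^ (2 * s - 1))⁻¹ * (((m₀ : ℝ) + 1) ^ e * (2 : ℝ)⁻¹ ^ m₀ * K.toReal)
      ≤ c * (N ^ (2 * s - 1))⁻¹ *
        ((2 * (e + 1) * (1 + Real.log R)) ^ e * N⁻¹ * (K.toReal + 1)) := by
        gcongr
        linarith
    _ = _ := by
      rw [mul_pow, mul_inv]
      ring

/-! ### Periodization, Bessel's inequality and Poisson summation -/

section

/-- The circle with its Haar probability measure. -/
noncomputable local instance unitAddCircleMeasureSpace : MeasureSpace UnitAddCircle :=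
  ⟨AddCircle.haarAddCircle⟩

local instance unitAddCircle_isProbabilityMeasure :
    IsProbabilityMeasure (volume : Measure UnitAddCircle) :=
  inferInstanceAs (IsProbabilityMeasure AddCircle.haarAddCircle)

/-- An integer vector as a real vector. -/
def intVec {d : ℕ} (m : Fin d → ℤ) : Fin d → ℝ := fun i => (m i : ℝ)

@[simp] lemma intVec_apply {d : ℕ} (m : Fin d → ℤ) (i : Fin d) : intVec m i = (m i : ℝ) := rfl

lemma intVec_add {d : ℕ} (m n : Fin d → ℤ) : intVec (m + n) = intVec m + intVec n := by
  ext i; simp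

/-- The quotient map from `ℝ^d` to the torus. -/
def toTorus {d : ℕ} (t : Fin d → ℝ) : UnitAddTorus (Fin d) := fun i => (t i : UnitAddCircle)

/-- The half-open unit cube. -/
def iocCube (d : ℕ) : Set (Fin d → ℝ) := {t | ∀ i, t i ∈ Set.Ioc (0 : ℝ) 1}

lemma toTorus_add_intVec {d : ℕ} (t : Fin d → ℝ) (m : Fin d → ℤ) :
    toTorus (t + intVec m) = toTorus t := by
  ext i
  simp [toTorus]

lemma isOpenQuotientMap_toTorus {d : ℕ} : IsOpenQuotientMap (toTorus (d := d)) :=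
  IsOpenQuotientMap.piMap (f := fun (_ : Fin d) (x : ℝ) => (x : UnitAddCircle))
    fun _ => QuotientAddGroup.isOpenQuotientMap_mk

lemma continuous_toTorus {d : ℕ} : Continuous (toTorus (d := d)) :=
  isOpenQuotientMap_toTorus.continuous

lemma measurableSet_iocCube (d : ℕ) : MeasurableSet (iocCube d) :=
  MeasurableSet.univ_pi' fun _ => measurableSet_Ioc

section Unfold

variable {d : ℕ} {E : Type*} [NormedAddCommGroup E]

/-- Only finitely many translates of a compactly supported function meet a ball. -/
lemma exists_finset_translates {h : (Fin d → ℝ) → E} (hs : HasCompactSupport h) (r : ℝ) :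
    ∃ S : Finset (Fin d → ℤ), ∀ t : Fin d → ℝ, ‖t‖ ≤ r → ∀ m ∉ S, h (t + intVec m) = 0 := by
  obtain ⟨ρ, hρ⟩ := hs.isCompact.isBounded.exists_norm_le
  obtain ⟨n, hn⟩ := exists_nat_ge (ρ + r)
  refine ⟨Fintype.piFinset fun _ => Finset.Icc (-(n : ℤ)) n, ?_⟩
  intro t ht m hm
  by_contra hne
  apply hm
  have h1 : ‖t + intVec m‖ ≤ ρ := hρ _ (subset_tsupport _ hne)
  rw [Fintype.mem_piFinset]
  intro i
  have h2 : |(m i : ℝ)| ≤ n := by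
    have h3 := norm_le_pi_norm (t + intVec m) i
    have h4 := norm_le_pi_norm t i
    rw [Real.norm_eq_abs] at h3 h4
    have h5 : (m i : ℝ) = (t + intVec m) i - t i := by simp
    rw [h5]
    have := abs_sub ((t + intVec m) i) (t i)
    linarith
  rw [Finset.mem_Icc]
  have h6 := abs_le.1 h2
  exact ⟨by exact_mod_cast h6.1, by exact_mod_cast h6.2⟩

lemma norm_le_one_of_mem_iocCube {t : Fin d → ℝ} (ht : t ∈ iocCube d) : ‖t‖ ≤ 1 := by
  rw [pi_norm_le_iff_of_nonneg zero_le_one]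
  intro i
  rw [Real.norm_eq_abs, abs_le]
  exact ⟨by linarith [(ht i).1], (ht i).2⟩

variable [NormedSpace ℝ E]

/-- The integral over `ℝ^d` as an integral of the periodization. -/
lemma integral_iocCube_tsum {H : (Fin d → ℝ) → E} (hc : Continuous H)
    (hs : HasCompactSupport H) :
    ∫ t in iocCube d, ∑' m, H (t + intVec m) = ∫ t, H t := by
  obtain ⟨S, hS⟩ := exists_finset_translates hs 1
  have hint : Integrable H := hc.integrable_of_hasCompactSupport hs
  set D : (Fin d → ℤ) → Set (Fin d → ℝ) := fun m => (· - intVec m) ⁻¹' iocCube d with hD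
  have hDm : ∀ m, MeasurableSet (D m) := fun m =>
    (measurable_sub_const _) (measurableSet_iocCube d)
  have hDd : Pairwise (Function.onFun Disjoint D) := by
    intro m n hmn
    rw [Function.onFun, Set.disjoint_left]
    intro t ht ht'
    apply hmn
    ext i
    have h1 := ht i
    have h2 := ht' i
    simp only [Pi.sub_apply, intVec_apply, Set.mem_Ioc] at h1 h2
    have h3 : (m i : ℝ) < n i + 1 := by linarith
    have h4 : (n i : ℝ) < m i + 1 := by linarith
    have h3' : m i < n i + 1 := by exact_mod_cast h3
    have h4' : n i < m i + 1 := by exact_mod_cast h4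
    omega
  have hDu : ⋃ m, D m = Set.univ := by
    rw [Set.eq_univ_iff_forall]
    intro t
    rw [Set.mem_iUnion]
    -- The cells are open on the left and closed on the right, hence the ceiling minus 1. They tile
    -- the space exactly, with no exceptional null set.
    refine ⟨fun i => ⌈t i⌉ - 1, fun i => ?_⟩
    have h1 := Int.ceil_lt_add_one (t i)
    have h2 := Int.le_ceil (t i)
    simp only [Pi.sub_apply, intVec_apply, Set.mem_Ioc]
    push_cast
    constructor <;> linarith
  have hDint : ∀ m, ∫ t in D m, H t = ∫ t in iocCube d, H (t + intVec m) := by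
    intro m
    have hmp : MeasurePreserving (fun t : Fin d → ℝ => t - intVec m) volume volume :=
      measurePreserving_sub_right _ _
    have := hmp.setIntegral_preimage_emb (MeasurableEquiv.subRight (intVec m)).measurableEmbedding
      (fun t => H (t + intVec m)) (iocCube d)
    simpa [hD] using this
  have h1 : ∫ t, H t = ∑' m, ∫ t in iocCube d, H (t + intVec m) := by
    rw [← setIntegral_univ, ← hDu, integral_iUnion hDm hDd (hDu ▸ hint.integrableOn)]
    simp only [hDint]
  have h2 : ∀ m ∉ S, ∫ t in iocCube d, H (t + intVec m) = 0 := by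
    intro m hm
    rw [setIntegral_congr_fun (g := fun _ => 0) (measurableSet_iocCube d)]
    · simp
    · intro t ht
      exact hS t (norm_le_one_of_mem_iocCube ht) m hm
  rw [h1, tsum_eq_sum h2, ← integral_finsetSum]
  · apply setIntegral_congr_fun (measurableSet_iocCube d)
    intro t ht
    exact tsum_eq_sum fun m hm => hS t (norm_le_one_of_mem_iocCube ht) m hm
  · intro m _
    exact ((hint.comp_add_right (intVec m))).integrableOn

end Unfold

section Periodization

variable {d : ℕ} {h : (Fin d → ℝ) → ℝ}

/-- The sum of all integer translates. -/
noncomputable def perSum (h : (Fin d → ℝ) → ℝ) (t : Fin d → ℝ) : ℝ := ∑' m, h (t + intVec m)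

lemma perSum_add_intVec (h : (Fin d → ℝ) → ℝ) (t : Fin d → ℝ) (n : Fin d → ℤ) :
    perSum h (t + intVec n) = perSum h t := by
  unfold perSum
  rw [← (Equiv.addLeft n).tsum_eq fun m => h (t + intVec m)]
  simp [intVec_add, add_assoc]

/-- On a ball around any point the series coincides with one fixed finite sum. -/
lemma continuous_perSum (hc : Continuous h) (hs : HasCompactSupport h) :
    Continuous (perSum h) := by
  rw [continuous_iff_continuousAt]
  intro t₀
  obtain ⟨S, hS⟩ := exists_finset_translates hs (‖t₀‖ + 1)
  have h1 : ∀ᶠ t in nhds t₀, perSum h t = ∑ m ∈ S, h (t + intVec m) := by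
    have h2 : ∀ᶠ t in nhds t₀, ‖t‖ < ‖t₀‖ + 1 :=
      continuous_norm.continuousAt.eventually (eventually_lt_nhds (by linarith))
    filter_upwards [h2] with t ht
    exact tsum_eq_sum fun m hm => hS t ht.le m hm
  refine ContinuousAt.congr ?_ (Filter.EventuallyEq.symm h1)
  exact (continuous_finsetSum _ fun m _ => by fun_prop).continuousAt

lemma exists_eq_add_intVec {t t' : Fin d → ℝ} (h : toTorus t = toTorus t') :
    ∃ n, t = t' + intVec n := by
  have h1 : ∀ i, ∃ n : ℤ, t i = t' i + n := by
    intro i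
    have h2 : ((t i : ℝ) : UnitAddCircle) = (t' i : ℝ) := congrFun h i
    obtain ⟨n, hn⟩ := AddSubgroup.mem_zmultiples_iff.1 (QuotientAddGroup.eq_iff_sub_mem.1 h2)
    refine ⟨n, ?_⟩
    rw [zsmul_eq_mul, mul_one] at hn
    linarith
  choose n hn using h1
  exact ⟨n, funext hn⟩

/-- The periodization of a function as a function on the torus. -/
noncomputable def periodize (hc : Continuous h) (hs : HasCompactSupport h) :
    C(UnitAddTorus (Fin d), ℂ) where
  -- The choice of the lift is immaterial because `perSum h` is invariant under integer
  -- translations.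
  toFun θ := (perSum h (Function.surjInv isOpenQuotientMap_toTorus.surjective θ) : ℂ)
  continuous_toFun := by
    rw [isOpenQuotientMap_toTorus.isQuotientMap.continuous_iff]
    have h1 : (fun θ : UnitAddTorus (Fin d) =>
        (perSum h (Function.surjInv isOpenQuotientMap_toTorus.surjective θ) : ℂ)) ∘ toTorus =
        fun t => (perSum h t : ℂ) := by
      ext t
      obtain ⟨n, hn⟩ := exists_eq_add_intVec
        (Function.surjInv_eq isOpenQuotientMap_toTorus.surjective (toTorus t))
      simp only [Function.comp_apply, hn, perSum_add_intVec]
    rw [h1]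
    exact Complex.continuous_ofReal.comp (continuous_perSum hc hs)

lemma periodize_toTorus (hc : Continuous h) (hs : HasCompactSupport h) (t : Fin d → ℝ) :
    periodize hc hs (toTorus t) = (perSum h t : ℂ) := by
  obtain ⟨n, hn⟩ := exists_eq_add_intVec
    (Function.surjInv_eq isOpenQuotientMap_toTorus.surjective (toTorus t))
  simp only [periodize, ContinuousMap.coe_mk, hn, perSum_add_intVec]

/-- The Fourier transform of `h` at the integer frequency `k`. -/
noncomputable def intFourier (h : (Fin d → ℝ) → ℝ) (k : Fin d → ℤ) : ℂ :=
  ∫ t, UnitAddTorus.mFourier (-k) (toTorus t) * (h t : ℂ)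

lemma setOf_ioc_eq_iocCube :
    {x : Fin d → ℝ | ∀ i, x i ∈ Set.Ioc ((0 : Fin d → ℝ) i) ((0 : Fin d → ℝ) i + 1)} =
    iocCube d := by
  simp [iocCube]

/-- The character is invariant under integer translations, so it can be moved inside the
periodization before unfolding the integral. -/
lemma mFourierCoeff_periodize (hc : Continuous h) (hs : HasCompactSupport h) (k : Fin d → ℤ) :
    UnitAddTorus.mFourierCoeff (periodize hc hs) k = intFourier h k := by
  rw [UnitAddTorus.mFourierCoeff_eq_integral _ k 0, setOf_ioc_eq_iocCube, intFourier,
    ← integral_iocCube_tsum]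
  · apply setIntegral_congr_fun (measurableSet_iocCube d)
    intro t _
    have h1 := periodize_toTorus hc hs t
    simp only [toTorus_add_intVec, tsum_mul_left, smul_eq_mul]
    rw [← Complex.ofReal_tsum]
    exact congrArg _ h1
  · exact ((UnitAddTorus.mFourier (-k)).continuous.comp continuous_toTorus).mul
      (Complex.continuous_ofReal.comp hc)
  · apply HasCompactSupport.mul_left
    exact hs.comp_left Complex.ofReal_zero

/-- Bessel's inequality for a function of which at most `K` integer translates overlap. -/
lemma sum_sq_intFourier_le (hc : Continuous h) (hs : HasCompactSupport h) {K : ℝ}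
    (hK : ∀ t, ({m | h (t + intVec m) ≠ 0}.ncard : ℝ) ≤ K) (T : Finset (Fin d → ℤ)) :
    ∑ k ∈ T, ‖intFourier h k‖ ^ 2 ≤ K * ∫ t, h t ^ 2 := by
  have h1 := UnitAddTorus.hasSum_sq_mFourierCoeff
    (ContinuousMap.toLp 2 volume ℂ (periodize hc hs))
  simp only [UnitAddTorus.mFourierCoeff_toLp, mFourierCoeff_periodize] at h1
  have h2 := sum_le_hasSum T (fun _ _ => by positivity) h1
  refine h2.trans ?_
  have h3 : ∫ θ, ‖(ContinuousMap.toLp 2 volume ℂ (periodize hc hs)) θ‖ ^ 2 =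
      ∫ θ, ‖periodize hc hs θ‖ ^ 2 := by
    apply integral_congr_ae
    filter_upwards [ContinuousMap.coeFn_toLp (p := 2) (𝕜 := ℂ) volume (periodize hc hs)] with θ hθ
    rw [hθ]
  have h4 : ∫ θ, ‖periodize hc hs θ‖ ^ 2 = ∫ t in iocCube d, perSum h t ^ 2 := by
    rw [UnitAddTorus.integral_preimage _ 0, setOf_ioc_eq_iocCube]
    apply setIntegral_congr_fun (measurableSet_iocCube d)
    intro t _
    have h1 := periodize_toTorus hc hs t
    change ‖periodize hc hs (toTorus t)‖ ^ 2 = _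
    simp only [h1, Complex.norm_real, Real.norm_eq_abs, sq_abs]
  have hs2 : HasCompactSupport fun t => h t ^ 2 := hs.comp_left (g := fun x => x ^ 2) (by simp)
  have hc2 : Continuous fun t => h t ^ 2 := hc.pow 2
  rw [h3, h4, ← integral_iocCube_tsum hc2 hs2, ← integral_const_mul]
  have hvol : volume (iocCube d) ≠ ⊤ := by
    have : iocCube d ⊆ Metric.closedBall 0 1 := fun t ht => by
      simpa using norm_le_one_of_mem_iocCube ht
    exact ((measure_mono this).trans_lt measure_closedBall_lt_top).ne
  have hcp := continuous_perSum hc hs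
  have hcp2 := continuous_perSum hc2 hs2
  have hio : ∀ F : (Fin d → ℝ) → ℝ, Continuous F → IntegrableOn F (iocCube d) := by
    intro F hF
    apply (hF.continuousOn.integrableOn_compact (isCompact_closedBall 0 1)).mono_set
    intro t ht
    simpa using norm_le_one_of_mem_iocCube ht
  apply setIntegral_mono_on
  · exact hio _ (hcp.pow 2)
  · exact (hio _ hcp2).const_mul K
  · exact measurableSet_iocCube d
  · intro t _
    obtain ⟨S, hS⟩ := exists_finset_translates hs ‖t‖
    classical
    set S' := S.filter fun m => h (t + intVec m) ≠ 0 with hS'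
    have hS'2 : ∀ m ∉ S', h (t + intVec m) = 0 := by
      intro m hm
      by_cases h5 : m ∈ S
      · by_contra h6
        exact hm (Finset.mem_filter.2 ⟨h5, h6⟩)
      · exact hS t le_rfl m h5
    have hcard : ({m | h (t + intVec m) ≠ 0}.ncard) = S'.card := by
      rw [← Set.ncard_coe_finset]
      congr 1
      ext m
      refine ⟨fun hm => ?_, fun hm => (Finset.mem_filter.1 hm).2⟩
      by_contra h6
      exact hm (hS'2 m h6)
    rw [perSum, tsum_eq_sum hS'2, tsum_eq_sum (s := S') (fun m hm => by rw [hS'2 m hm]; simp)]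
    -- Cauchy-Schwarz on the at most `K` nonzero translates at `t`; integrating over the cell then
    -- unfolds `∑ h^2` to the whole space.
    refine sq_sum_le_card_mul_sum_sq.trans ?_
    have := hK t
    rw [hcard] at this
    gcongr

/-- The error of the lattice sum `∑ h(m)` in terms of weighted Fourier coefficients. -/
theorem sq_tsum_sub_integral_le (hc : Continuous h) (hs : HasCompactSupport h)
    (w : (Fin d → ℤ) → ℝ) (hw : ∀ k, 0 < w k) {W V : ℝ} (hW : 0 ≤ W)
    (hsum : ∑' k, (if k = 0 then 0 else ENNReal.ofReal (w k)⁻¹) ≤ ENNReal.ofReal W)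
    (hV : ∀ T : Finset (Fin d → ℤ), ∑ k ∈ T, w k * ‖intFourier h k‖ ^ 2 ≤ V) :
    (∑' m, h (intVec m) - ∫ t, h t) ^ 2 ≤ W * V := by
  classical
  have hfin : ∀ T : Finset (Fin d → ℤ), (∑ k ∈ T.erase 0, ‖intFourier h k‖) ^ 2 ≤ W * V := by
    intro T
    have h1 : ∑ k ∈ T.erase 0, (w k)⁻¹ ≤ W := by
      rw [← ENNReal.ofReal_le_ofReal_iff hW]
      refine le_trans ?_ hsum
      rw [ENNReal.ofReal_sum_of_nonneg fun k _ => (inv_pos.2 (hw k)).le]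
      refine le_trans (Finset.sum_le_sum fun k hk => ?_) (ENNReal.sum_le_tsum (T.erase 0))
      rw [if_neg (Finset.ne_of_mem_erase hk)]
    have h2 := Finset.sum_mul_sq_le_sq_mul_sq (T.erase 0) (fun k => Real.sqrt (w k)⁻¹)
      (fun k => Real.sqrt (w k) * ‖intFourier h k‖)
    have h3 : ∀ k, Real.sqrt (w k)⁻¹ * (Real.sqrt (w k) * ‖intFourier h k‖) = ‖intFourier h k‖ := by
      intro k
      rw [← mul_assoc, ← Real.sqrt_mul (inv_pos.2 (hw k)).le, inv_mul_cancel₀ (hw k).ne',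
        Real.sqrt_one, one_mul]
    have h4 : ∀ k, Real.sqrt (w k)⁻¹ ^ 2 = (w k)⁻¹ := fun k => Real.sq_sqrt (inv_pos.2 (hw k)).le
    have h5 : ∀ k, (Real.sqrt (w k) * ‖intFourier h k‖) ^ 2 = w k * ‖intFourier h k‖ ^ 2 := by
      intro k
      rw [mul_pow, Real.sq_sqrt (hw k).le]
    simp only [h3, h4, h5] at h2
    refine h2.trans ?_
    exact mul_le_mul h1 (hV _) (Finset.sum_nonneg fun k _ =>
      mul_nonneg (hw k).le (by positivity)) hW
  have hWV : 0 ≤ W * V := (sq_nonneg _).trans (hfin ∅)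
  have hfin' : ∀ T : Finset (Fin d → ℤ), ∑ k ∈ T.erase 0, ‖intFourier h k‖ ≤ Real.sqrt (W * V) :=
    fun T => Real.le_sqrt_of_sq_le (hfin T)
  -- The bound on finite sums leaves out frequency zero, which is added separately. Absolute
  -- summability makes the Fourier series converge pointwise, and its value at the origin is
  -- Poisson's formula.
  have hsummable : Summable fun k => intFourier h k := by
    apply Summable.of_norm
    apply summable_of_sum_le (c := Real.sqrt (W * V) + ‖intFourier h 0‖) (fun _ => norm_nonneg _)
    intro T
    calc ∑ k ∈ T, ‖intFourier h k‖ ≤ ∑ k ∈ insert 0 T, ‖intFourier h k‖ :=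
          Finset.sum_le_sum_of_subset_of_nonneg (Finset.subset_insert _ _)
            fun _ _ _ => norm_nonneg _
      _ = ‖intFourier h 0‖ + ∑ k ∈ (insert 0 T).erase 0, ‖intFourier h k‖ :=
          (Finset.add_sum_erase _ _ (Finset.mem_insert_self _ _)).symm
      _ ≤ _ := by linarith [hfin' (insert 0 T)]
  have hpois : HasSum (fun k => intFourier h k) ((∑' m, h (intVec m) : ℝ) : ℂ) := by
    have h1 : Summable (UnitAddTorus.mFourierCoeff (periodize hc hs)) := by
      refine hsummable.congr fun k => ?_
      rw [mFourierCoeff_periodize]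
    have h2 := UnitAddTorus.hasSum_mFourier_series_apply_of_summable h1 (toTorus 0)
    rw [periodize_toTorus] at h2
    simp only [mFourierCoeff_periodize] at h2
    convert! h2 using 2 with k
    · have : UnitAddTorus.mFourier k (toTorus 0) = 1 := by
        simp [UnitAddTorus.mFourier, toTorus]
      rw [this]; simp
    · simp [perSum]
  have hzero : intFourier h 0 = ((∫ t, h t : ℝ) : ℂ) := by
    rw [intFourier, neg_zero, UnitAddTorus.mFourier_zero, ← integral_complex_ofReal]
    simp
  -- The coefficient at zero is the integral, so removing it leaves the error.
  have hdiff : HasSum (fun k => if k = 0 then 0 else intFourier h k)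
      ((∑' m, h (intVec m) - ∫ t, h t : ℝ) : ℂ) := by
    have := hpois.update 0 0
    rw [hzero] at this
    convert! this using 1
    · ext k
      by_cases hk : k = 0 <;> simp [hk, Function.update]
    · push_cast; ring
  have hbound : ‖((∑' m, h (intVec m) - ∫ t, h t : ℝ) : ℂ)‖ ≤ Real.sqrt (W * V) := by
    refine le_of_tendsto (hdiff.norm) (Filter.Eventually.of_forall fun T => ?_)
    refine (norm_sum_le _ _).trans ?_
    refine le_trans (le_of_eq ?_) (hfin' T)
    rw [← Finset.sum_erase (a := 0) T (by simp)]
    apply Finset.sum_congr rfl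
    intro k hk
    rw [if_neg (Finset.ne_of_mem_erase hk)]
  rw [Complex.norm_real, Real.norm_eq_abs] at hbound
  rw [← sq_abs]
  calc _ ≤ Real.sqrt (W * V) ^ 2 := by gcongr
    _ = _ := Real.sq_sqrt hWV

end Periodization

end

/-! ### Fourier coefficients of mixed derivatives along a lattice -/

/-- Iterated partial derivatives along a list of coordinates. -/
noncomputable def listD {d : ℕ} (l : List (Fin d)) (α : Fin d → ℕ) (f : (Fin d → ℝ) → ℝ) :
    (Fin d → ℝ) → ℝ :=
  l.foldr (fun i g => (partialD i)^[α i] g) f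

/-- Mixed derivatives are treated for an arbitrary list of coordinates, which allows induction over
the coordinates. -/
lemma mixedD_eq_listD {d : ℕ} (α : Fin d → ℕ) (f : (Fin d → ℝ) → ℝ) :
    mixedD α f = listD (List.finRange d) α f := rfl

lemma sum_map_finRange {d : ℕ} {β : Type*} [AddCommMonoid β] (α : Fin d → β) :
    ((List.finRange d).map α).sum = ∑ i, α i := (Fin.sum_univ_def α).symm

section

variable {d : ℕ} {f g : (Fin d → ℝ) → ℝ}

lemma partialD_eq_fderiv (i : Fin d) {x : Fin d → ℝ} (hf : DifferentiableAt ℝ f x) :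
    partialD i f x = fderiv ℝ f x (Pi.single i 1) :=
  hf.lineDeriv_eq_fderiv

lemma ContDiff.partialD {n : ℕ} (i : Fin d) (hf : ContDiff ℝ ((n + 1 : ℕ) : WithTop ℕ∞) f) :
    ContDiff ℝ (n : WithTop ℕ∞) (partialD i f) := by
  have h0 : (((n + 1 : ℕ) : WithTop ℕ∞)) ≠ 0 := by simp
  have h1 : _root_.partialD i f = fun x => fderiv ℝ f x (Pi.single i 1) := by
    ext x
    exact partialD_eq_fderiv i (hf.differentiable h0 x)
  rw [h1]
  exact (hf.fderiv_right (by norm_cast)).clm_apply contDiff_const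

lemma lineDeriv_zero_fun {E F : Type*} [AddCommGroup E] [Module ℝ E] [NormedAddCommGroup F]
    [NormedSpace ℝ F] {x v : E} : lineDeriv ℝ (0 : E → F) x v = 0 := by
  simp [lineDeriv]

lemma tsupport_partialD_subset (i : Fin d) : tsupport (partialD i f) ⊆ tsupport f := by
  apply closure_minimal _ isClosed_closure
  intro x hx
  by_contra h
  apply hx
  have h1 : f =ᶠ[nhds x] 0 := notMem_tsupport_iff_eventuallyEq.1 h
  have h2 : lineDeriv ℝ f x (Pi.single i 1) = lineDeriv ℝ 0 x (Pi.single i 1) :=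
    h1.lineDeriv_eq
  rw [partialD, h2]
  exact lineDeriv_zero_fun

lemma contDiff_iterate_partialD (i : Fin d) (a : ℕ) {n : ℕ}
    (hf : ContDiff ℝ ((n + a : ℕ) : WithTop ℕ∞) f) :
    ContDiff ℝ (n : WithTop ℕ∞) ((partialD i)^[a] f) := by
  induction a generalizing n with
  | zero => exact hf
  | succ a ih =>
    rw [Function.iterate_succ_apply']
    exact ContDiff.partialD i (ih (by rwa [add_right_comm, add_assoc]))

lemma tsupport_iterate_partialD_subset (i : Fin d) (a : ℕ) :
    tsupport ((partialD i)^[a] f) ⊆ tsupport f := by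
  induction a with
  | zero => exact subset_rfl
  | succ a ih =>
    rw [Function.iterate_succ_apply']
    exact (tsupport_partialD_subset i).trans ih

lemma contDiff_listD (l : List (Fin d)) (α : Fin d → ℕ) {n : ℕ}
    (hf : ContDiff ℝ ((n + (l.map α).sum : ℕ) : WithTop ℕ∞) f) :
    ContDiff ℝ (n : WithTop ℕ∞) (listD l α f) := by
  induction l generalizing n with
  | nil => simpa [listD] using hf
  | cons i l ih =>
    apply contDiff_iterate_partialD i (α i)
    apply ih
    rw [List.map_cons, List.sum_cons] at hf
    rwa [add_assoc]

lemma tsupport_listD_subset (l : List (Fin d)) (α : Fin d → ℕ) :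
    tsupport (listD l α f) ⊆ tsupport f := by
  induction l with
  | nil => exact subset_rfl
  | cons i l ih => exact (tsupport_iterate_partialD_subset i (α i)).trans ih

lemma mFourier_toTorus (k : Fin d → ℤ) (t : Fin d → ℝ) :
    UnitAddTorus.mFourier k (toTorus t) =
      Complex.exp (2 * Real.pi * Complex.I * ∑ j, (k j : ℂ) * (t j : ℂ)) := by
  simp only [UnitAddTorus.mFourier, ContinuousMap.coe_mk, toTorus, fourier_coe_apply,
    Finset.mul_sum, Complex.exp_sum]
  apply Finset.prod_congr rfl
  intro j _
  congr 1
  push_cast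
  ring

lemma hasLineDerivAt_mFourier (k : Fin d → ℤ) (t v : Fin d → ℝ) :
    HasLineDerivAt ℝ (fun t => UnitAddTorus.mFourier k (toTorus t))
      (2 * Real.pi * Complex.I * (∑ j, (k j : ℂ) * (v j : ℂ)) *
        UnitAddTorus.mFourier k (toTorus t)) t v := by
  unfold HasLineDerivAt
  simp only [mFourier_toTorus]
  have h1 : HasDerivAt (fun r : ℝ => 2 * Real.pi * Complex.I *
      ∑ j, (k j : ℂ) * (((t + r • v) j : ℝ) : ℂ))
      (2 * Real.pi * Complex.I * (∑ j, (k j : ℂ) * (v j : ℂ))) 0 := by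
    apply HasDerivAt.const_mul
    apply HasDerivAt.fun_sum
    intro j _
    apply HasDerivAt.const_mul
    have h2 : HasDerivAt (fun r : ℝ => (t + r • v) j) (v j) 0 := by
      simpa using ((hasDerivAt_id (0 : ℝ)).mul_const (v j)).const_add (t j)
    exact h2.ofReal_comp
  have h3 := h1.cexp
  simp only [zero_smul, add_zero] at h3
  rw [mul_comm _ (Complex.exp _)]
  exact h3

open Matrix in
/-- The Fourier transform turns a partial derivative into a multiplication. -/
lemma intFourier_partialD (M N : Matrix (Fin d) (Fin d) ℝ) (hMN : M * N = 1) (i : Fin d)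
    (hg : ContDiff ℝ 1 g)
    (hs' : HasCompactSupport fun t => g (M *ᵥ t))
    (k : Fin d → ℤ) :
    intFourier (fun t => partialD i g (M *ᵥ t)) k =
      2 * Real.pi * Complex.I * ((Nᵀ *ᵥ intVec k) i : ℝ) * intFourier (fun t => g (M *ᵥ t)) k := by
  -- Column `i` of `N = M⁻¹` is mapped by `M` to the `i`-th unit vector, so `∂_i g` at `M t` is the
  -- derivative of `g ∘ M` along `v`. Integration by parts moves it to the character.
  set v : Fin d → ℝ := fun j => N j i with hv
  have hMv : M *ᵥ v = Pi.single i 1 := by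
    ext j
    have := congrFun (congrFun hMN j) i
    rw [Matrix.mul_apply] at this
    simp only [Matrix.mulVec, dotProduct, hv, this, Matrix.one_apply, Pi.single_apply]
  have hline : ∀ t, HasLineDerivAt ℝ (fun t => g (M *ᵥ t)) (partialD i g (M *ᵥ t)) t v := by
    intro t
    have h1 := (hg.differentiable one_ne_zero (M *ᵥ t)).lineDifferentiableAt
      (v := Pi.single i 1) |>.hasLineDerivAt
    unfold HasLineDerivAt at h1 ⊢
    simp only [Matrix.mulVec_add, Matrix.mulVec_smul, hMv]
    exact h1
  have hlineC : ∀ t, HasLineDerivAt ℝ (fun t => (g (M *ᵥ t) : ℂ))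
      (partialD i g (M *ᵥ t) : ℂ) t v := fun t => (hline t).ofReal_comp
  have hcM : Continuous fun t : Fin d → ℝ => M *ᵥ t := by fun_prop
  have hgc : Continuous fun t => (g (M *ᵥ t) : ℂ) :=
    Complex.continuous_ofReal.comp (hg.continuous.comp hcM)
  have hpc : Continuous fun t => (partialD i g (M *ᵥ t) : ℂ) :=
    Complex.continuous_ofReal.comp
      ((ContDiff.partialD (n := 0) i (by simpa using hg)).continuous.comp hcM)
  have hgs : HasCompactSupport fun t => (g (M *ᵥ t) : ℂ) := hs'.comp_left Complex.ofReal_zero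
  have hps : HasCompactSupport fun t => (partialD i g (M *ᵥ t) : ℂ) := by
    apply HasCompactSupport.intro hgs.isCompact
    intro t ht
    have h1 := notMem_tsupport_iff_eventuallyEq.1 ht
    have h2 := h1.lineDeriv_eq (v := v) (𝕜 := ℝ)
    rw [(hlineC t).lineDeriv] at h2
    rw [h2]
    exact lineDeriv_zero_fun
  have hE : Continuous fun t : Fin d → ℝ => UnitAddTorus.mFourier (-k) (toTorus t) :=
    (UnitAddTorus.mFourier (-k)).continuous.comp continuous_toTorus
  have hibp := integral_bilinear_hasLineDerivAt_right_eq_neg_left_of_integrable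
    (μ := (volume : Measure (Fin d → ℝ))) (B := ContinuousLinearMap.mul ℝ ℂ) (v := v)
    (f := fun t => UnitAddTorus.mFourier (-k) (toTorus t))
    (f' := fun t => 2 * Real.pi * Complex.I * (∑ j, (((-k) j : ℤ) : ℂ) * (v j : ℂ)) *
        UnitAddTorus.mFourier (-k) (toTorus t))
    (g := fun t => (g (M *ᵥ t) : ℂ)) (g' := fun t => (partialD i g (M *ᵥ t) : ℂ))
    ?_ ?_ ?_ (fun t _ => hasLineDerivAt_mFourier (-k) t v) (fun t _ => hlineC t)
  · simp only [ContinuousLinearMap.mul_apply'] at hibp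
    rw [intFourier, hibp, intFourier]
    simp only [mul_assoc]
    rw [integral_const_mul, integral_const_mul, integral_const_mul, integral_const_mul]
    have h4 : (∑ j, (((-k) j : ℤ) : ℂ) * (v j : ℂ)) = -(((Nᵀ *ᵥ intVec k) i : ℝ) : ℂ) := by
      simp only [Matrix.mulVec, dotProduct, Matrix.transpose_apply, hv, intVec_apply]
      push_cast
      rw [← Finset.sum_neg_distrib]
      apply Finset.sum_congr rfl
      intro j _
      push_cast [Pi.neg_apply]
      ring
    rw [h4]
    ring
  · simp only [ContinuousLinearMap.mul_apply']
    exact ((continuous_const.mul hE).mul hgc).integrable_of_hasCompactSupport hgs.mul_left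
  · simp only [ContinuousLinearMap.mul_apply']
    exact (hE.mul hpc).integrable_of_hasCompactSupport hps.mul_left
  · simp only [ContinuousLinearMap.mul_apply']
    exact (hE.mul hgc).integrable_of_hasCompactSupport hgs.mul_left

open Matrix in
lemma hasCompactSupport_comp_mulVec {M N : Matrix (Fin d) (Fin d) ℝ} (hNM : N * M = 1)
    (hs : HasCompactSupport g) : HasCompactSupport fun t => g (M *ᵥ t) := by
  apply HasCompactSupport.intro (K := (fun t => N *ᵥ t) '' tsupport g)
    (hs.isCompact.image (by fun_prop))
  intro t ht
  by_contra h
  exact ht ⟨M *ᵥ t, subset_tsupport _ h, by simp [Matrix.mulVec_mulVec, hNM]⟩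

open Matrix in
lemma intFourier_listD {M N : Matrix (Fin d) (Fin d) ℝ} (hMN : M * N = 1) (l : List (Fin d))
    (α : Fin d → ℕ) (hg : ContDiff ℝ (((l.map α).sum : ℕ) : WithTop ℕ∞) g)
    (hs : HasCompactSupport g) (k : Fin d → ℤ) :
    intFourier (fun t => listD l α g (M *ᵥ t)) k =
      (l.map fun i => (2 * Real.pi * Complex.I * ((Nᵀ *ᵥ intVec k) i : ℝ)) ^ α i).prod *
        intFourier (fun t => g (M *ᵥ t)) k := by
  have hNM : N * M = 1 := mul_eq_one_comm.1 hMN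
  induction l with
  | nil => simp [listD]
  | cons i l ih =>
    rw [List.map_cons, List.sum_cons] at hg
    -- The function `u` is quantified inside the induction because the innermost derivative is
    -- peeled off first, and the hypothesis is then applied to `partialD i u`.
    have key : ∀ a : ℕ, ∀ u : (Fin d → ℝ) → ℝ, ContDiff ℝ (a : WithTop ℕ∞) u →
        HasCompactSupport u → intFourier (fun t => (partialD i)^[a] u (M *ᵥ t)) k =
        (2 * Real.pi * Complex.I * ((Nᵀ *ᵥ intVec k) i : ℝ)) ^ a *
          intFourier (fun t => u (M *ᵥ t)) k := by
      intro a
      induction a with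
      | zero => intro u _ _; simp
      | succ a iha =>
        intro u hu hus
        have hu1 : ContDiff ℝ 1 u := hu.of_le (by norm_cast; omega)
        have h1 : HasCompactSupport (partialD i u) :=
          hus.isCompact.of_isClosed_subset (isClosed_tsupport _) (tsupport_partialD_subset i)
        rw [Function.iterate_succ_apply, iha _ (ContDiff.partialD i hu) h1,
          intFourier_partialD M N hMN i hu1 (hasCompactSupport_comp_mulVec hNM hus) k, pow_succ]
        ring
    have h2 : HasCompactSupport (listD l α g) :=
      hs.isCompact.of_isClosed_subset (isClosed_tsupport _) (tsupport_listD_subset l α)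
    have h3 := key (α i) (listD l α g) (contDiff_listD l α hg) h2
    rw [List.map_cons, List.prod_cons, mul_assoc,
      ← ih (hg.of_le (by norm_cast; omega))]
    exact h3

/-- A single summand suffices: take order `s` in the coordinates with `|ξ i| ≥ 1` and order 0 in the
others. The factor `2 π ≥ 1` only helps. -/
lemma mixWeight_le_sum (s : ℕ) (ξ : Fin d → ℝ) :
    mixWeight s ξ ≤
      ∑ α ∈ Finset.Iic (fun _ : Fin d => s), ∏ i, |2 * Real.pi * ξ i| ^ (2 * α i) := by
  classical
  set α : Fin d → ℕ := fun i => if 1 ≤ |ξ i| then s else 0 with hα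
  have h1 : α ∈ Finset.Iic (fun _ : Fin d => s) := by
    rw [Finset.mem_Iic]
    intro i
    simp only [hα]
    split_ifs <;> simp
  refine le_trans ?_ (Finset.single_le_sum
    (f := fun α : Fin d → ℕ => ∏ i, |2 * Real.pi * ξ i| ^ (2 * α i))
    (fun _ _ => Finset.prod_nonneg fun _ _ => by positivity) h1)
  apply Finset.prod_le_prod (fun _ _ => by positivity)
  intro i _
  simp only [hα]
  split_ifs with h
  · rw [max_eq_right h]
    refine pow_le_pow_left₀ (abs_nonneg _) ?_ _
    rw [abs_mul, abs_of_pos (show 0 < 2 * Real.pi by positivity)]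
    apply le_mul_of_one_le_left (abs_nonneg _)
    linarith [Real.pi_gt_three]
  · rw [max_eq_left (not_le.1 h).le]
    simp

open Matrix in
lemma integral_comp_mulVec {M : Matrix (Fin d) (Fin d) ℝ} (hM : M.det ≠ 0) {F : (Fin d → ℝ) → ℝ}
    (hF : Continuous F) : ∫ t, F (M *ᵥ t) = |M.det|⁻¹ * ∫ x, F x := by
  have h1 := Real.map_matrix_volume_pi_eq_smul_volume_pi hM
  have h2 := integral_map (μ := (volume : Measure (Fin d → ℝ))) (φ := Matrix.toLin' M) (f := F)
    (by
      apply Continuous.aemeasurable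
      exact LinearMap.continuous_of_finiteDimensional _) hF.aestronglyMeasurable
  rw [h1, integral_smul_measure] at h2
  simp only [Matrix.toLin'_apply] at h2
  rw [← h2, ENNReal.toReal_ofReal (abs_nonneg _), abs_inv, smul_eq_mul]

open Matrix in
/-- Bessel's inequality for all mixed derivatives. -/
theorem sum_mixWeight_intFourier_le {M N : Matrix (Fin d) (Fin d) ℝ} (hMN : M * N = 1) {s : ℕ}
    (hg : ContDiff ℝ ((s * d : ℕ) : WithTop ℕ∞) g) (hs : HasCompactSupport g) {K : ℝ}
    (hKfin : ∀ t, {m | M *ᵥ (t + intVec m) ∈ tsupport g}.Finite)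
    (hK : ∀ t, ({m | M *ᵥ (t + intVec m) ∈ tsupport g}.ncard : ℝ) ≤ K)
    (T : Finset (Fin d → ℤ)) :
    ∑ k ∈ T, mixWeight s (Nᵀ *ᵥ intVec k) * ‖intFourier (fun t => g (M *ᵥ t)) k‖ ^ 2 ≤
      K * |M.det|⁻¹ * ∑ α ∈ Finset.Iic (fun _ : Fin d => s), ∫ x, mixedD α g x ^ 2 := by
  have hNM : N * M = 1 := mul_eq_one_comm.1 hMN
  have hdet : M.det ≠ 0 := by
    intro h
    have := congrArg Matrix.det hMN
    rw [Matrix.det_mul, h] at this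
    simp at this
  have hsum : ∀ α ∈ Finset.Iic (fun _ : Fin d => s), ((List.finRange d).map α).sum ≤ s * d := by
    intro α hα
    rw [sum_map_finRange]
    calc ∑ i, α i ≤ ∑ _i : Fin d, s := Finset.sum_le_sum fun i _ => Finset.mem_Iic.1 hα i
      _ = s * d := by simp [mul_comm]
  have hcD : ∀ α ∈ Finset.Iic (fun _ : Fin d => s), Continuous (mixedD α g) := by
    intro α hα
    rw [mixedD_eq_listD]
    refine (contDiff_listD (n := 0) _ α (hg.of_le ?_)).continuous
    rw [zero_add]
    exact_mod_cast hsum α hα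
  have hsD : ∀ α, HasCompactSupport (mixedD α g) := fun α =>
    hs.isCompact.of_isClosed_subset (isClosed_tsupport _) (tsupport_listD_subset _ α)
  have hcM : Continuous fun t : Fin d → ℝ => M *ᵥ t := by fun_prop
  calc ∑ k ∈ T, mixWeight s (Nᵀ *ᵥ intVec k) * ‖intFourier (fun t => g (M *ᵥ t)) k‖ ^ 2
      ≤ ∑ k ∈ T, ∑ α ∈ Finset.Iic (fun _ : Fin d => s),
          ‖intFourier (fun t => mixedD α g (M *ᵥ t)) k‖ ^ 2 := by
        apply Finset.sum_le_sum
        intro k _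
        refine (mul_le_mul_of_nonneg_right (mixWeight_le_sum s _) (by positivity)).trans ?_
        rw [Finset.sum_mul]
        apply Finset.sum_le_sum
        intro α hα
        rw [mixedD_eq_listD, intFourier_listD hMN _ α (hg.of_le (by exact_mod_cast hsum α hα)) hs,
          norm_mul, mul_pow]
        gcongr
        rw [← Fin.prod_univ_def, norm_prod, ← Finset.prod_pow]
        apply le_of_eq
        apply Finset.prod_congr rfl
        intro i _
        rw [norm_pow, ← pow_mul, mul_comm (α i) 2]
        congr 1
        simp [abs_mul]
    _ = ∑ α ∈ Finset.Iic (fun _ : Fin d => s), ∑ k ∈ T,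
          ‖intFourier (fun t => mixedD α g (M *ᵥ t)) k‖ ^ 2 := Finset.sum_comm
    -- Differentiation does not enlarge the topological support, so the same overlap bound `K`
    -- serves for every `α`.
    _ ≤ ∑ α ∈ Finset.Iic (fun _ : Fin d => s), K * ∫ t, mixedD α g (M *ᵥ t) ^ 2 := by
        apply Finset.sum_le_sum
        intro α hα
        apply sum_sq_intFourier_le ((hcD α hα).comp hcM) (hasCompactSupport_comp_mulVec hNM (hsD α))
        intro t
        refine le_trans ?_ (hK t)
        have : {m | mixedD α g (M *ᵥ (t + intVec m)) ≠ 0} ⊆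
            {m | M *ᵥ (t + intVec m) ∈ tsupport g} := fun m hm =>
          tsupport_listD_subset _ α (subset_tsupport _ hm)
        exact_mod_cast Set.ncard_le_ncard this (hKfin t)
    _ = _ := by
        rw [Finset.mul_sum]
        apply Finset.sum_congr rfl
        intro α hα
        rw [integral_comp_mulVec hdet (F := fun x => mixedD α g x ^ 2) ((hcD α hα).pow 2)]
        ring

end

/-! ### The one-dimensional change of variables -/

/-- A smooth change of variables on `[0,1]` whose derivative is `κ η^(2 s)`, where `η` is smooth,
positive on `(0,1)` and zero elsewhere. -/
structure CoordChange (s : ℕ) where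
  /-- The change of variables. -/
  toFun : ℝ → ℝ
  /-- The function `η` in the derivative `κ η^(2 s)`. -/
  bump : ℝ → ℝ
  /-- The constant `κ` in the derivative `κ η^(2 s)`. -/
  scale : ℝ
  scale_pos : 0 < scale
  contDiff_bump : ContDiff ℝ ∞ bump
  bump_pos : ∀ t ∈ Set.Ioo (0 : ℝ) 1, 0 < bump t
  bump_eq_zero : ∀ t ∉ Set.Ioo (0 : ℝ) 1, bump t = 0
  hasDerivAt : ∀ t, HasDerivAt toFun (scale * bump t ^ (2 * s)) t
  map_zero : toFun 0 = 0
  map_one : toFun 1 = 1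

/-- The bump is a product of two copies of `expNegInvGlue`, flat at 0 and at 1; the map is the
primitive of its power, normalized to the value 1 at 1. -/
theorem nonempty_coordChange {s : ℕ} : Nonempty (CoordChange s) := by
  set η : ℝ → ℝ := fun t => expNegInvGlue t * expNegInvGlue (1 - t) with hη
  have hηc : ContDiff ℝ ∞ η :=
    expNegInvGlue.contDiff.mul (expNegInvGlue.contDiff.comp (contDiff_const.sub contDiff_id))
  have hpos : ∀ t ∈ Set.Ioo (0 : ℝ) 1, 0 < η t := fun t ht =>
    mul_pos (expNegInvGlue.pos_of_pos ht.1) (expNegInvGlue.pos_of_pos (by linarith [ht.2]))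
  have hzero : ∀ t ∉ Set.Ioo (0 : ℝ) 1, η t = 0 := by
    intro t ht
    simp only [hη]
    rcases le_or_gt t 0 with h | h
    · rw [expNegInvGlue.zero_of_nonpos h, zero_mul]
    · have : 1 ≤ t := by
        by_contra! h'
        exact ht ⟨h, h'⟩
      rw [expNegInvGlue.zero_of_nonpos (by linarith : 1 - t ≤ 0), mul_zero]
  have hc : Continuous fun t => η t ^ (2 * s) := hηc.continuous.pow _
  set I := ∫ t in (0 : ℝ)..1, η t ^ (2 * s) with hI
  have hIpos : 0 < I :=
    intervalIntegral.intervalIntegral_pos_of_pos_on (hc.intervalIntegrable _ _)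
      (fun t ht => pow_pos (hpos t ht) _) zero_lt_one
  refine ⟨⟨fun t => I⁻¹ * ∫ u in (0 : ℝ)..t, η u ^ (2 * s), η, I⁻¹, inv_pos.2 hIpos, hηc, hpos,
    hzero, ?_, ?_, ?_⟩⟩
  · intro t
    exact (intervalIntegral.integral_hasDerivAt_right (hc.intervalIntegrable _ _)
      (hc.stronglyMeasurableAtFilter _ _) hc.continuousAt).const_mul _
  · simp
  · exact inv_mul_cancel₀ hIpos.ne'

namespace CoordChange

variable {s : ℕ} (X : CoordChange s)

/-- The derivative of the change of variables. -/
noncomputable def density (t : ℝ) : ℝ := X.scale * X.bump t ^ (2 * s)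

lemma bump_nonneg (t : ℝ) : 0 ≤ X.bump t := by
  by_cases ht : t ∈ Set.Ioo (0 : ℝ) 1
  · exact (X.bump_pos t ht).le
  · exact (X.bump_eq_zero t ht).ge

lemma density_nonneg (t : ℝ) : 0 ≤ X.density t :=
  mul_nonneg X.scale_pos.le (pow_nonneg (X.bump_nonneg t) _)

lemma density_pos {t : ℝ} (ht : t ∈ Set.Ioo (0 : ℝ) 1) : 0 < X.density t :=
  mul_pos X.scale_pos (pow_pos (X.bump_pos t ht) _)

lemma density_eq_zero (hs : 1 ≤ s) {t : ℝ} (ht : t ∉ Set.Ioo (0 : ℝ) 1) : X.density t = 0 := by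
  rw [density, X.bump_eq_zero t ht, zero_pow (by omega), mul_zero]

lemma contDiff_density : ContDiff ℝ ∞ X.density := contDiff_const.mul (X.contDiff_bump.pow _)

lemma differentiable : Differentiable ℝ X.toFun := fun t => (X.hasDerivAt t).differentiableAt

lemma deriv_eq : deriv X.toFun = X.density := funext fun t => (X.hasDerivAt t).deriv

lemma contDiff : ContDiff ℝ ∞ X.toFun := by
  rw [contDiff_infty_iff_deriv, X.deriv_eq]
  exact ⟨X.differentiable, X.contDiff_density⟩

lemma monotone : Monotone X.toFun :=
  monotone_of_deriv_nonneg X.differentiable fun t => by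
    rw [X.deriv_eq]
    exact X.density_nonneg t

lemma strictMonoOn : StrictMonoOn X.toFun (Set.Icc 0 1) := by
  apply strictMonoOn_of_deriv_pos (convex_Icc 0 1) X.contDiff.continuous.continuousOn
  intro t ht
  rw [interior_Icc] at ht
  rw [X.deriv_eq]
  exact X.density_pos ht

lemma toFun_eq_of_nonpos (hs : 1 ≤ s) {t : ℝ} (ht : t ≤ 0) : X.toFun t = 0 := by
  have h1 : ∀ x ∈ Set.Icc t 0, X.toFun x = X.toFun t := by
    apply constant_of_has_deriv_right_zero X.contDiff.continuous.continuousOn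
    intro x hx
    have h2 := (X.hasDerivAt x).hasDerivWithinAt (s := Set.Ici x)
    have h3 : X.scale * X.bump x ^ (2 * s) = 0 :=
      X.density_eq_zero hs fun h => by linarith [h.1, hx.2]
    rwa [h3] at h2
  rw [← h1 0 ⟨ht, le_rfl⟩, X.map_zero]

lemma toFun_eq_of_one_le (hs : 1 ≤ s) {t : ℝ} (ht : 1 ≤ t) : X.toFun t = 1 := by
  have h1 : ∀ x ∈ Set.Icc 1 t, X.toFun x = X.toFun 1 := by
    apply constant_of_has_deriv_right_zero X.contDiff.continuous.continuousOn
    intro x hx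
    have h2 := (X.hasDerivAt x).hasDerivWithinAt (s := Set.Ici x)
    have h3 : X.scale * X.bump x ^ (2 * s) = 0 :=
      X.density_eq_zero hs fun h => by linarith [h.2, hx.1]
    rwa [h3] at h2
  rw [h1 t ⟨ht, le_rfl⟩, X.map_one]

lemma mem_Icc (hs : 1 ≤ s) (t : ℝ) : X.toFun t ∈ Set.Icc (0 : ℝ) 1 := by
  constructor
  · rw [← X.toFun_eq_of_nonpos hs (min_le_right t 0)]
    exact X.monotone (min_le_left _ _)
  · rw [← X.toFun_eq_of_one_le hs (le_max_right t 1)]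
    exact X.monotone (le_max_left _ _)

lemma image_Ioo : X.toFun '' Set.Ioo 0 1 = Set.Ioo 0 1 := by
  apply Set.Subset.antisymm
  · rintro _ ⟨t, ht, rfl⟩
    constructor
    · rw [← X.map_zero]
      exact X.strictMonoOn ⟨le_rfl, zero_le_one⟩ ⟨ht.1.le, ht.2.le⟩ ht.1
    · rw [← X.map_one]
      exact X.strictMonoOn ⟨ht.1.le, ht.2.le⟩ ⟨zero_le_one, le_rfl⟩ ht.2
  · have := intermediate_value_Ioo (zero_le_one' ℝ) X.contDiff.continuous.continuousOn
    rwa [X.map_zero, X.map_one] at this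

/-- Smooth functions that vanish to order `q` where the bump vanishes. -/
def Vanishing (q : ℕ) (b : ℝ → ℝ) : Prop :=
  ∃ e : ℝ → ℝ, ContDiff ℝ ∞ e ∧ b = fun t => X.bump t ^ q * e t

variable {X}

lemma Vanishing.contDiff {q : ℕ} {b : ℝ → ℝ} (hb : X.Vanishing q b) : ContDiff ℝ ∞ b := by
  obtain ⟨e, he, rfl⟩ := hb
  exact (X.contDiff_bump.pow q).mul he

lemma Vanishing.mono {q q' : ℕ} (h : q' ≤ q) {b : ℝ → ℝ} (hb : X.Vanishing q b) :
    X.Vanishing q' b := by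
  obtain ⟨e, he, rfl⟩ := hb
  refine ⟨fun t => X.bump t ^ (q - q') * e t, (X.contDiff_bump.pow _).mul he, ?_⟩
  ext t
  rw [← mul_assoc, ← pow_add, Nat.add_sub_cancel' h]

lemma Vanishing.mul {q : ℕ} {b c : ℝ → ℝ} (hb : X.Vanishing q b) (hc : ContDiff ℝ ∞ c) :
    X.Vanishing q fun t => b t * c t := by
  obtain ⟨e, he, rfl⟩ := hb
  exact ⟨fun t => e t * c t, he.mul hc, by ext t; ring⟩

/-- The derivative of `η^(q+1) e` is `η^q ((q+1) η' e + η e')`: each differentiation costs one order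
of vanishing. -/
lemma Vanishing.deriv {q : ℕ} {b : ℝ → ℝ} (hb : X.Vanishing (q + 1) b) :
    X.Vanishing q (deriv b) := by
  obtain ⟨e, he, rfl⟩ := hb
  have hb' := contDiff_infty_iff_deriv.1 X.contDiff_bump
  have he' := contDiff_infty_iff_deriv.1 he
  refine ⟨fun t => (q + 1) * _root_.deriv X.bump t * e t + X.bump t * _root_.deriv e t,
    ((contDiff_const.mul hb'.2).mul he).add (X.contDiff_bump.mul he'.2), ?_⟩
  ext t
  have h1 := ((hb'.1 t).hasDerivAt.pow (q + 1)).mul (he'.1 t).hasDerivAt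
  have h2 := h1.deriv
  simp only [Nat.add_sub_cancel] at h2
  refine Eq.trans ?_ (h2.trans ?_)
  · rfl
  · simp only [Pi.pow_apply]
    push_cast
    ring

variable (X)

lemma vanishing_density : X.Vanishing (2 * s) X.density :=
  ⟨fun _ => X.scale, contDiff_const, by ext t; rw [density, mul_comm]⟩

/-- The square of a function vanishing to order `s` is controlled by the density. -/
lemma Vanishing.sq_le (hs : 1 ≤ s) {b : ℝ → ℝ} (hb : X.Vanishing s b) :
    ∃ K : ℝ, 0 ≤ K ∧ ∀ t, b t ^ 2 ≤ K * X.density t := by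
  obtain ⟨e, he, rfl⟩ := hb
  -- With `b = η^s e`, the square is `η^(2s) e^2`. Only the bound of `e` on `[0,1]` is needed, since
  -- both sides vanish outside `(0,1)`.
  obtain ⟨c, hc⟩ := (isCompact_Icc (a := (0 : ℝ)) (b := 1)).exists_bound_of_continuousOn
    he.continuous.continuousOn
  have hc0 : 0 ≤ c := (norm_nonneg _).trans (hc 0 ⟨le_rfl, zero_le_one⟩)
  refine ⟨c ^ 2 / X.scale, div_nonneg (sq_nonneg _) X.scale_pos.le, fun t => ?_⟩
  by_cases ht : t ∈ Set.Ioo (0 : ℝ) 1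
  · have h1 := hc t ⟨ht.1.le, ht.2.le⟩
    rw [Real.norm_eq_abs] at h1
    have h2 : e t ^ 2 ≤ c ^ 2 := by
      rw [← sq_abs (e t)]
      gcongr
    rw [density, ← mul_assoc, div_mul_cancel₀ _ X.scale_pos.ne', mul_pow, ← pow_mul, mul_comm s 2,
      mul_comm]
    exact mul_le_mul_of_nonneg_right h2 (pow_nonneg (X.bump_nonneg t) _)
  · beta_reduce
    rw [X.density_eq_zero hs ht, X.bump_eq_zero t ht, zero_pow (by omega)]
    simp

end CoordChange

/-! ### Mixed derivatives of the transformed function -/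

section OpenCube

variable {d : ℕ} {f : (Fin d → ℝ) → ℝ}

lemma isOpen_openUnitCube : IsOpen (openUnitCube d) :=
  isOpen_set_pi Set.finite_univ fun _ _ => isOpen_Ioo

lemma contDiffOn_partialD {n : ℕ} (i : Fin d)
    (hf : ContDiffOn ℝ ((n + 1 : ℕ) : WithTop ℕ∞) f (openUnitCube d)) :
    ContDiffOn ℝ (n : WithTop ℕ∞) (partialD i f) (openUnitCube d) := by
  have h0 : (((n + 1 : ℕ) : WithTop ℕ∞)) ≠ 0 := by simp
  have h1 : ContDiffOn ℝ (n : WithTop ℕ∞) (fun x => fderiv ℝ f x (Pi.single i 1))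
      (openUnitCube d) :=
    (hf.fderiv_of_isOpen isOpen_openUnitCube (by norm_cast)).clm_apply contDiffOn_const
  refine h1.congr fun x hx => partialD_eq_fderiv i ?_
  exact (hf.differentiableOn h0).differentiableAt (isOpen_openUnitCube.mem_nhds hx)

lemma contDiffOn_iterate_partialD (i : Fin d) (a : ℕ) {n : ℕ}
    (hf : ContDiffOn ℝ ((n + a : ℕ) : WithTop ℕ∞) f (openUnitCube d)) :
    ContDiffOn ℝ (n : WithTop ℕ∞) ((partialD i)^[a] f) (openUnitCube d) := by
  induction a generalizing n with
  | zero => exact hf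
  | succ a ih =>
    rw [Function.iterate_succ_apply']
    exact contDiffOn_partialD i (ih (by rwa [add_right_comm, add_assoc]))

lemma contDiffOn_listD (l : List (Fin d)) (α : Fin d → ℕ) {n : ℕ}
    (hf : ContDiffOn ℝ ((n + (l.map α).sum : ℕ) : WithTop ℕ∞) f (openUnitCube d)) :
    ContDiffOn ℝ (n : WithTop ℕ∞) (listD l α f) (openUnitCube d) := by
  induction l generalizing n with
  | nil => simpa [listD] using hf
  | cons i l ih =>
    apply contDiffOn_iterate_partialD i (α i)
    apply ih
    rw [List.map_cons, List.sum_cons] at hf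
    rwa [add_assoc]

lemma listD_congr (l : List (Fin d)) {α β : Fin d → ℕ} (h : ∀ i ∈ l, α i = β i) :
    listD l α f = listD l β f := by
  induction l with
  | nil => rfl
  | cons i l ih =>
    have h1 := ih fun j hj => h j (List.mem_cons_of_mem _ hj)
    change (partialD i)^[α i] (listD l α f) = (partialD i)^[β i] (listD l β f)
    rw [h1, h i List.mem_cons_self]

end OpenCube

namespace CoordChange

variable {s d : ℕ} (X : CoordChange s)

/-- The change of variables in every coordinate, contracted by the factor `r` to the center of the
cube. -/
noncomputable def cubeMap (r : ℝ) (x : Fin d → ℝ) : Fin d → ℝ :=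
  fun i => (1 - r) / 2 + r * X.toFun (x i)

/-- The function `f ∘ Ψ` times a product of functions of one coordinate. -/
noncomputable def term (r : ℝ) (f : (Fin d → ℝ) → ℝ) (b : Fin d → ℝ → ℝ) (x : Fin d → ℝ) : ℝ :=
  f (X.cubeMap r x) * ∏ i, b i (x i)

lemma contDiff_cubeMap (r : ℝ) : ContDiff ℝ ∞ (X.cubeMap (d := d) r) :=
  contDiff_pi.2 fun i => contDiff_const.add (contDiff_const.mul
    (X.contDiff.comp (contDiff_apply ℝ ℝ i)))

lemma cubeMap_mem_openUnitCube (hs : 1 ≤ s) {r : ℝ} (hr : r ∈ Set.Ioo (0 : ℝ) 1)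
    (x : Fin d → ℝ) : X.cubeMap r x ∈ openUnitCube d := by
  intro i _
  have h1 := X.mem_Icc hs (x i)
  have h2 : 0 ≤ r * X.toFun (x i) := mul_nonneg hr.1.le h1.1
  have h3 : r * X.toFun (x i) ≤ r := mul_le_of_le_one_right hr.1.le h1.2
  constructor
  · simp only [cubeMap]; linarith [hr.2]
  · simp only [cubeMap]; linarith [hr.2]

variable {X} {f : (Fin d → ℝ) → ℝ} {r : ℝ}

/-- This is the purpose of the contraction: for `r < 1` all of `ℝ^d` is mapped into the open cube,
so smoothness of `f` there gives smoothness everywhere, without touching boundary derivatives. -/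
lemma contDiff_term (hs : 1 ≤ s) (hr : r ∈ Set.Ioo (0 : ℝ) 1) {n : ℕ}
    (hf : ContDiffOn ℝ (n : WithTop ℕ∞) f (openUnitCube d)) {b : Fin d → ℝ → ℝ}
    (hb : ∀ i, ContDiff ℝ ∞ (b i)) : ContDiff ℝ (n : WithTop ℕ∞) (X.term r f b) := by
  have hn : (n : WithTop ℕ∞) ≤ (∞ : WithTop ℕ∞) := by exact_mod_cast le_top
  apply ContDiff.mul
  · rw [contDiff_iff_contDiffAt]
    intro x
    have h1 : ContDiffAt ℝ (n : WithTop ℕ∞) f (X.cubeMap r x) :=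
      hf.contDiffAt (isOpen_openUnitCube.mem_nhds (X.cubeMap_mem_openUnitCube hs hr x))
    exact h1.comp x ((X.contDiff_cubeMap r).of_le hn).contDiffAt
  · apply contDiff_prod
    intro i _
    exact ((hb i).of_le hn).comp (contDiff_apply ℝ ℝ i)

lemma prod_update (b : Fin d → ℝ → ℝ) (i : Fin d) (c : ℝ → ℝ) (x : Fin d → ℝ) :
    ∏ j, Function.update b i c j (x j) = c (x i) * ∏ j ∈ Finset.univ.erase i, b j (x j) := by
  rw [← Finset.mul_prod_erase _ _ (Finset.mem_univ i), Function.update_self]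
  congr 1
  apply Finset.prod_congr rfl
  intro j hj
  rw [Function.update_of_ne (Finset.ne_of_mem_erase hj)]

/-- The product and chain rules for `term`. -/
lemma hasLineDerivAt_term (hs : 1 ≤ s) (hr : r ∈ Set.Ioo (0 : ℝ) 1)
    (hf : ContDiffOn ℝ 1 f (openUnitCube d)) {b : Fin d → ℝ → ℝ} {i : Fin d}
    (hb : Differentiable ℝ (b i)) (x : Fin d → ℝ) :
    HasLineDerivAt ℝ (X.term r f b)
      (r * X.term r (partialD i f) (Function.update b i fun t => b i t * X.density t) x +
        X.term r f (Function.update b i (deriv (b i))) x) x (Pi.single i 1) := by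
  set y := X.cubeMap r x with hy
  have hfd : DifferentiableAt ℝ f y := (hf.differentiableOn one_ne_zero).differentiableAt
    (isOpen_openUnitCube.mem_nhds (X.cubeMap_mem_openUnitCube hs hr x))
  have hcurve : HasDerivAt (fun q : ℝ => X.cubeMap r (x + q • Pi.single i 1))
      ((r * X.density (x i)) • (Pi.single i 1 : Fin d → ℝ)) 0 := by
    rw [hasDerivAt_pi]
    intro j
    simp only [cubeMap]
    by_cases hj : j = i
    · subst hj
      have h1 : HasDerivAt (fun q : ℝ => x j + q) 1 0 := (hasDerivAt_id 0).const_add _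
      have h2 := X.hasDerivAt (x j + 0)
      have h3 := ((h2.comp (0 : ℝ) h1).const_mul r).const_add ((1 - r) / 2)
      simpa [density, Function.comp_def] using h3
    · simp only [Pi.add_apply, Pi.smul_apply, Pi.single_eq_of_ne hj, smul_zero, add_zero]
      exact hasDerivAt_const _ _
  have hcomp : HasDerivAt (fun q : ℝ => f (X.cubeMap r (x + q • Pi.single i 1)))
      (r * X.density (x i) * partialD i f y) 0 := by
    have h1 : HasFDerivAt f (fderiv ℝ f y) (X.cubeMap r (x + (0 : ℝ) • Pi.single i 1)) := by
      rw [zero_smul, add_zero]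
      exact hfd.hasFDerivAt
    have h2 := h1.comp_hasDerivAt (0 : ℝ) hcurve
    rw [map_smul, ← partialD_eq_fderiv i hfd, smul_eq_mul] at h2
    exact h2
  have hprod : ∀ q : ℝ, ∏ j, b j ((x + q • (Pi.single i 1 : Fin d → ℝ)) j) =
      b i (x i + q) * ∏ j ∈ Finset.univ.erase i, b j (x j) := by
    intro q
    rw [← Finset.mul_prod_erase _ _ (Finset.mem_univ i)]
    congr 1
    · simp
    · apply Finset.prod_congr rfl
      intro j hj
      simp [Pi.single_eq_of_ne (Finset.ne_of_mem_erase hj)]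
  have hprodD : HasDerivAt (fun q : ℝ => ∏ j, b j ((x + q • (Pi.single i 1 : Fin d → ℝ)) j))
      (deriv (b i) (x i) * ∏ j ∈ Finset.univ.erase i, b j (x j)) 0 := by
    simp only [hprod]
    apply HasDerivAt.mul_const
    have h1 : HasDerivAt (fun q : ℝ => x i + q) 1 0 := (hasDerivAt_id 0).const_add _
    have h2 := (hb (x i + 0)).hasDerivAt.comp (0 : ℝ) h1
    simpa [Function.comp_def] using h2
  have h := hcomp.mul hprodD
  unfold HasLineDerivAt
  convert! h using 1
  simp only [term, prod_update, ← hy, zero_smul, add_zero]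
  rw [← Finset.mul_prod_erase _ _ (Finset.mem_univ i)]
  ring

/-- The iterated partial derivative in one coordinate of `term`. -/
lemma exists_iterate_partialD_term (X : CoordChange s) (hs : 1 ≤ s) (a : ℕ) (ha : a ≤ 2 * s) :
    ∃ (ι : Type) (_ : Fintype ι) (p : ι → ℕ) (c : ι → ℝ → ℝ),
      (∀ t, p t ≤ a) ∧ (∀ t, X.Vanishing (2 * s - a) (c t)) ∧
      ∀ (d : ℕ) (i : Fin d) (f : (Fin d → ℝ) → ℝ) (b : Fin d → ℝ → ℝ) (r : ℝ),
        r ∈ Set.Ioo (0 : ℝ) 1 → ContDiffOn ℝ (a : WithTop ℕ∞) f (openUnitCube d) →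
        b i = X.density →
        (partialD i)^[a] (X.term r f b) =
          fun x =>
            ∑ t, r ^ p t * X.term r ((partialD i)^[p t] f) (Function.update b i (c t)) x := by
  induction a with
  | zero =>
    refine ⟨Unit, inferInstance, fun _ => 0, fun _ => X.density, fun _ => le_rfl,
      fun _ => X.vanishing_density, ?_⟩
    intro d i f b r _ _ hbi
    ext x
    simp [← hbi]
  | succ a ih =>
    obtain ⟨ι, hι, p, c, hp, hc, hD⟩ := ih (by omega)
    have hq : 2 * s - a = 2 * s - (a + 1) + 1 := by omega
    -- Each term splits in two. If the derivative hits `f`, the chain rule adds an order to `f`, a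
    -- factor `r` and a factor of the density; if it hits the coefficient, one order of vanishing is
    -- lost.
    refine ⟨ι ⊕ ι, inferInstance, Sum.elim (fun t => p t + 1) p,
      Sum.elim (fun t u => c t u * X.density u) (fun t => deriv (c t)), ?_, ?_, ?_⟩
    · rintro (t | t)
      · exact Nat.succ_le_succ (hp t)
      · exact (hp t).trans (Nat.le_succ a)
    · rintro (t | t)
      · exact ((hc t).mono (by omega)).mul X.contDiff_density
      · exact (hq ▸ hc t).deriv
    · intro d i f b r hr hf hbi
      rw [Function.iterate_succ_apply', hD d i f b r hr (hf.of_le (by norm_cast; omega)) hbi]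
      ext x
      have h1 : ∀ t, HasLineDerivAt ℝ
          (fun x => r ^ p t * X.term r ((partialD i)^[p t] f) (Function.update b i (c t)) x)
          (r ^ p t * (r * X.term r ((partialD i)^[p t + 1] f)
              (Function.update b i fun u => c t u * X.density u) x +
            X.term r ((partialD i)^[p t] f) (Function.update b i (deriv (c t))) x))
          x (Pi.single i 1) := by
        intro t
        have h2 : ContDiffOn ℝ 1 ((partialD i)^[p t] f) (openUnitCube d) := by
          have := contDiffOn_iterate_partialD (f := f) (n := 1) i (p t)
            (hf.of_le (by have := hp t; norm_cast; omega))
          exact_mod_cast this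
        have h3 := hasLineDerivAt_term (X := X) (b := Function.update b i (c t)) (i := i) hs hr h2
          (by rw [Function.update_self]; exact (hc t).contDiff.differentiable (by simp)) x
        simp only [Function.update_self, Function.update_idem] at h3
        rw [Function.iterate_succ_apply']
        exact HasDerivAt.const_mul _ h3
      have h4 : HasLineDerivAt ℝ (fun x => ∑ t, r ^ p t *
          X.term r ((partialD i)^[p t] f) (Function.update b i (c t)) x) _ x (Pi.single i 1) :=
        HasDerivAt.fun_sum fun t _ => h1 t
      rw [partialD, h4.lineDeriv, Fintype.sum_sum_type, ← Finset.sum_add_distrib]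
      apply Finset.sum_congr rfl
      intro t _
      simp only [Sum.elim_inl, Sum.elim_inr, pow_succ]
      ring

/-- Smoothness is required because `lineDeriv` is additive only where the line derivatives exist. -/
lemma iterate_partialD_sum {ι : Type*} [Fintype ι] (i : Fin d) (a : ℕ) (c : ι → ℝ)
    (u : ι → (Fin d → ℝ) → ℝ) (hu : ∀ t, ContDiff ℝ (a : WithTop ℕ∞) (u t)) :
    (partialD i)^[a] (fun x => ∑ t, c t * u t x) =
      fun x => ∑ t, c t * (partialD i)^[a] (u t) x := by
  induction a generalizing u with
  | zero => rfl
  | succ a ih =>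
    have h1 : partialD i (fun x => ∑ t, c t * u t x) = fun x => ∑ t, c t * partialD i (u t) x := by
      ext x
      have h2 : ∀ t, HasLineDerivAt ℝ (fun x => c t * u t x) (c t * partialD i (u t) x) x
          (Pi.single i 1) := by
        intro t
        have h3 := ((hu t).differentiable (by simp) x).lineDifferentiableAt
          (v := Pi.single i 1) |>.hasLineDerivAt
        exact HasDerivAt.const_mul _ h3
      have h4 : HasLineDerivAt ℝ (fun x => ∑ t, c t * u t x) _ x (Pi.single i 1) :=
        HasDerivAt.fun_sum fun t _ => h2 t
      exact h4.lineDeriv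
    rw [Function.iterate_succ_apply, h1, ih _ fun t => ContDiff.partialD i (hu t)]
    rfl

/-- Mixed derivatives of `term` are combinations of mixed derivatives with coefficients that are
controlled by the density. -/
lemma exists_listD_term (X : CoordChange s) (hs : 1 ≤ s) (l : List (Fin d)) (hl : l.Nodup)
    (α : Fin d → ℕ) (hα : ∀ i, α i ≤ s) :
    ∃ (ι : Type) (_ : Fintype ι) (e : ι → ℕ) (β : ι → Fin d → ℕ) (b : ι → Fin d → ℝ → ℝ),
      (∀ t i, β t i ≤ s) ∧ (∀ t, ∀ i ∉ l, b t i = X.density) ∧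
      (∀ t i, X.Vanishing s (b t i)) ∧
      ∀ (f : (Fin d → ℝ) → ℝ) (r : ℝ), r ∈ Set.Ioo (0 : ℝ) 1 →
        ContDiffOn ℝ ((s * d : ℕ) : WithTop ℕ∞) f (openUnitCube d) →
        listD l α (X.term r f fun _ => X.density) =
          fun x => ∑ t, r ^ e t * X.term r (listD l (β t) f) (b t) x := by
  induction l with
  | nil =>
    refine ⟨Unit, inferInstance, fun _ => 0, fun _ _ => 0, fun _ _ => X.density, by simp,
      by simp, fun _ _ => X.vanishing_density.mono (by omega), ?_⟩
    intro f r _ _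
    ext x
    simp [listD]
  | cons i l ih =>
    obtain ⟨hil, hl'⟩ := List.nodup_cons.1 hl
    obtain ⟨ι, hι, e, β, b, hβ, hb, hbv, hD⟩ := ih hl'
    obtain ⟨ι', hι', p, c, hp, hc, hD'⟩ := exists_iterate_partialD_term X hs (α i)
      ((hα i).trans (by omega))
    refine ⟨ι × ι', inferInstance, fun t => e t.1 + p t.2,
      fun t => Function.update (β t.1) i (p t.2), fun t => Function.update (b t.1) i (c t.2),
      ?_, ?_, ?_, ?_⟩
    · intro t j
      beta_reduce
      by_cases hj : j = i
      · subst hj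
        rw [Function.update_self]
        exact (hp _).trans (hα _)
      · rw [Function.update_of_ne hj]
        exact hβ _ _
    · intro t j hj
      rw [List.mem_cons, not_or] at hj
      beta_reduce
      rw [Function.update_of_ne hj.1]
      exact hb _ _ hj.2
    · intro t j
      beta_reduce
      by_cases hj : j = i
      · subst hj
        rw [Function.update_self]
        exact (hc _).mono (by have := hα j; omega)
      · rw [Function.update_of_ne hj]
        exact hbv _ _
    · intro f r hr hf
      -- The list has no repetitions, so at most `d` coordinates are differentiated, each at most
      -- `s` times, and the total order stays within `s * d`.
      have hlen : l.length + 1 ≤ d := by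
        have := hl.length_le_card
        simpa using this
      have hfD : ∀ t, ContDiffOn ℝ (α i : WithTop ℕ∞) (listD l (β t) f) (openUnitCube d) := by
        intro t
        apply contDiffOn_listD
        apply hf.of_le
        have h1 : (l.map (β t)).sum ≤ l.length * s := by
          have := List.sum_le_card_nsmul (l.map (β t)) s (by
            intro x hx
            obtain ⟨j, _, rfl⟩ := List.mem_map.1 hx
            exact hβ t j)
          simpa using this
        have h2 : α i + (l.map (β t)).sum ≤ s * d := by
          have := hα i
          nlinarith
        exact_mod_cast h2
      change (partialD i)^[α i] (listD l α (X.term r f fun _ => X.density)) = _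
      rw [hD f r hr hf, iterate_partialD_sum i (α i) (fun t => r ^ e t)
        (fun t => X.term r (listD l (β t) f) (b t))
        (fun t => contDiff_term hs hr (hfD t) fun j => (hbv t j).contDiff)]
      ext x
      rw [Fintype.sum_prod_type]
      apply Finset.sum_congr rfl
      intro t _
      -- Coordinate `i` has not been differentiated yet, so its coefficient is still the density, as
      -- the one-coordinate formula requires.
      rw [hD' d i _ (b t) r hr (hfD t) (hb t i hil), Finset.mul_sum]
      apply Finset.sum_congr rfl
      intro t' _
      have h3 : listD (i :: l) (Function.update (β t) i (p t')) f =
          (partialD i)^[p t'] (listD l (β t) f) := by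
        change (partialD i)^[Function.update (β t) i (p t') i] (listD l _ f) = _
        rw [Function.update_self, listD_congr l (β := β t)]
        intro j hj
        rw [Function.update_of_ne]
        rintro rfl
        exact hil hj
      simp only [h3, pow_add]
      ring

end CoordChange

/-! ### Boundedness of the change of variables in the mixed norm -/

section CubeMeasure

variable {d : ℕ}

lemma measurableSet_openUnitCube : MeasurableSet (openUnitCube d) :=
  isOpen_openUnitCube.measurableSet

lemma openUnitCube_subset_unitCube : openUnitCube d ⊆ unitCube d := fun _ hx =>
  ⟨fun i => (hx i trivial).1.le, fun i => (hx i trivial).2.le⟩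

lemma cubeMeasure_eq_restrict_open : cubeMeasure d = volume.restrict (openUnitCube d) :=
  (Measure.restrict_congr_set Measure.univ_pi_Ioo_ae_eq_Icc).symm

instance : IsProbabilityMeasure (cubeMeasure d) := by
  constructor
  rw [cubeMeasure, Measure.restrict_apply_univ, unitCube, Real.volume_Icc_pi]
  simp

lemma eLpNorm_two_sq {f : (Fin d → ℝ) → ℝ} {μ : Measure (Fin d → ℝ)} :
    eLpNorm f 2 μ ^ 2 = ∫⁻ x, ENNReal.ofReal (f x ^ 2) ∂μ := by
  rw [eLpNorm_eq_lintegral_rpow_enorm_toReal two_ne_zero ENNReal.ofNat_ne_top]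
  have h1 : ∀ y : ℝ≥0∞, (y ^ (1 / (2 : ℝ≥0∞).toReal)) ^ 2 = y := by
    intro y
    rw [← ENNReal.rpow_natCast, ← ENNReal.rpow_mul]
    simp
  rw [h1]
  apply lintegral_congr
  intro x
  rw [← sq_abs, ENNReal.ofReal_pow (abs_nonneg _), Real.enorm_eq_ofReal_abs]
  simp

lemma sum_eLpNorm_sq_le_of_mixNormOfFamily_le {s : ℕ} {F : (Fin d → ℕ) → (Fin d → ℝ) → ℝ} {ε : ℝ≥0∞}
    (h : mixNormOfFamily s F ≤ ε) {α : Fin d → ℕ} (hα : α ∈ Finset.Iic fun _ : Fin d => s) :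
    eLpNorm (F α) 2 (cubeMeasure d) ^ 2 ≤ ε ^ 2 := by
  have h1 : mixNormOfFamily s F ^ 2 =
      ∑ α ∈ Finset.Iic (fun _ : Fin d => s), eLpNorm (F α) 2 (cubeMeasure d) ^ 2 := by
    rw [mixNormOfFamily, ← ENNReal.rpow_natCast, ← ENNReal.rpow_mul]
    simp
  calc eLpNorm (F α) 2 (cubeMeasure d) ^ 2
      ≤ ∑ α ∈ Finset.Iic (fun _ : Fin d => s), eLpNorm (F α) 2 (cubeMeasure d) ^ 2 :=
        Finset.single_le_sum (f := fun α => eLpNorm (F α) 2 (cubeMeasure d) ^ 2)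
          (fun _ _ => zero_le) hα
    _ = mixNormOfFamily s F ^ 2 := h1.symm
    _ ≤ ε ^ 2 := by gcongr

end CubeMeasure

namespace CoordChange

variable {s d : ℕ} (X : CoordChange s)

/-- The derivative of the change of variables in the cube. -/
noncomputable def cubeMapDeriv (r : ℝ) (x : Fin d → ℝ) : (Fin d → ℝ) →L[ℝ] (Fin d → ℝ) :=
  ContinuousLinearMap.pi fun i => (r * X.density (x i)) • ContinuousLinearMap.proj (R := ℝ) i

lemma hasFDerivAt_cubeMap (r : ℝ) (x : Fin d → ℝ) :
    HasFDerivAt (X.cubeMap r) (X.cubeMapDeriv r x) x := by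
  apply hasFDerivAt_pi.2
  intro i
  have h1 : HasFDerivAt (fun y : Fin d → ℝ => y i) (ContinuousLinearMap.proj (R := ℝ) i) x :=
    hasFDerivAt_apply i x
  have h2 := (X.hasDerivAt (x i)).comp_hasFDerivAt x h1
  have h3 := (h2.const_mul r).const_add ((1 - r) / 2)
  rw [smul_smul] at h3
  exact h3

lemma det_cubeMapDeriv (r : ℝ) (x : Fin d → ℝ) :
    (X.cubeMapDeriv r x).det = r ^ d * ∏ i, X.density (x i) := by
  have h1 : ((X.cubeMapDeriv r x : (Fin d → ℝ) →L[ℝ] (Fin d → ℝ)) :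
      (Fin d → ℝ) →ₗ[ℝ] (Fin d → ℝ)) =
      Matrix.toLin' (Matrix.diagonal fun i => r * X.density (x i)) := by
    ext v i
    simp [cubeMapDeriv, Matrix.mulVec_diagonal]
  rw [ContinuousLinearMap.det, h1, LinearMap.det_toLin', Matrix.det_diagonal,
    Finset.prod_mul_distrib]
  simp

lemma injOn_cubeMap {r : ℝ} (hr : r ≠ 0) : Set.InjOn (X.cubeMap (d := d) r) (openUnitCube d) := by
  intro x hx y hy hxy
  ext i
  have h1 := congrFun hxy i
  simp only [cubeMap] at h1
  have h2 : X.toFun (x i) = X.toFun (y i) := mul_left_cancel₀ hr (add_left_cancel h1)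
  exact X.strictMonoOn.injOn ⟨(hx i trivial).1.le, (hx i trivial).2.le⟩
    ⟨(hy i trivial).1.le, (hy i trivial).2.le⟩ h2

lemma cubeMap_one_apply (x : Fin d → ℝ) (i : Fin d) : X.cubeMap 1 x i = X.toFun (x i) := by
  simp [cubeMap]

lemma image_cubeMap_one : X.cubeMap 1 '' openUnitCube d = openUnitCube d := by
  ext y
  constructor
  · rintro ⟨x, hx, rfl⟩ i hi
    rw [cubeMap_one_apply, ← X.image_Ioo]
    exact ⟨x i, hx i hi, rfl⟩
  · intro hy
    have h1 : ∀ i, ∃ t ∈ Set.Ioo (0 : ℝ) 1, X.toFun t = y i := by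
      intro i
      have := hy i trivial
      rwa [← X.image_Ioo] at this
    choose x hx hxy using h1
    refine ⟨x, fun i _ => hx i, ?_⟩
    ext i
    rw [cubeMap_one_apply, hxy]

lemma cubeMap_one_mem_unitCube (hs : 1 ≤ s) (x : Fin d → ℝ) : X.cubeMap 1 x ∈ unitCube d := by
  constructor
  · intro i
    rw [cubeMap_one_apply]
    exact (X.mem_Icc hs _).1
  · intro i
    rw [cubeMap_one_apply]
    exact (X.mem_Icc hs _).2

lemma prod_density_nonneg (x : Fin d → ℝ) : 0 ≤ ∏ i, X.density (x i) :=
  Finset.prod_nonneg fun _ _ => X.density_nonneg _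

lemma prod_density_eq_zero (hs : 1 ≤ s) {x : Fin d → ℝ} (hx : x ∉ openUnitCube d) :
    ∏ i, X.density (x i) = 0 := by
  simp only [openUnitCube, Set.mem_pi, Set.mem_univ, true_implies, not_forall] at hx
  obtain ⟨i, hi⟩ := hx
  exact Finset.prod_eq_zero (Finset.mem_univ i) (X.density_eq_zero hs hi)

/-- The change of variables formula, as an inequality. -/
lemma lintegral_comp_cubeMap_le (hs : 1 ≤ s) {r : ℝ} (hr : r ∈ Set.Ioo (0 : ℝ) 1)
    (F : (Fin d → ℝ) → ℝ≥0∞) :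
    ∫⁻ x, F (X.cubeMap r x) * ENNReal.ofReal (∏ i, X.density (x i)) ≤
      ENNReal.ofReal (r ^ d)⁻¹ * ∫⁻ x, F x ∂(cubeMeasure d) := by
  have hrd : 0 < r ^ d := pow_pos hr.1 d
  have h1 := lintegral_image_eq_lintegral_abs_det_fderiv_mul volume
    (measurableSet_openUnitCube (d := d))
    (fun x _ => (X.hasFDerivAt_cubeMap r x).hasFDerivWithinAt) (X.injOn_cubeMap hr.1.ne') F
  have h2 : ∫⁻ x, F (X.cubeMap r x) * ENNReal.ofReal (∏ i, X.density (x i)) =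
      ∫⁻ x in openUnitCube d, F (X.cubeMap r x) * ENNReal.ofReal (∏ i, X.density (x i)) := by
    rw [← lintegral_indicator measurableSet_openUnitCube]
    apply lintegral_congr
    intro x
    by_cases hx : x ∈ openUnitCube d
    · rw [Set.indicator_of_mem hx]
    · rw [Set.indicator_of_notMem hx, X.prod_density_eq_zero hs hx]
      simp
  have h3 : ∫⁻ x in openUnitCube d, F (X.cubeMap r x) * ENNReal.ofReal (∏ i, X.density (x i)) =
      ENNReal.ofReal (r ^ d)⁻¹ * ∫⁻ x in X.cubeMap r '' openUnitCube d, F x := by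
    rw [h1, ← lintegral_const_mul' _ _ ENNReal.ofReal_ne_top]
    apply lintegral_congr
    intro x
    rw [X.det_cubeMapDeriv, abs_of_nonneg (mul_nonneg hrd.le (X.prod_density_nonneg x)),
      ENNReal.ofReal_mul hrd.le, ← mul_assoc, ← mul_assoc, ← ENNReal.ofReal_mul (by positivity),
      inv_mul_cancel₀ hrd.ne', ENNReal.ofReal_one, one_mul, mul_comm]
  rw [h2, h3, cubeMeasure_eq_restrict_open]
  gcongr
  -- For `r < 1` the image is only a part of the cube, hence an inequality.
  rintro _ ⟨x, _, rfl⟩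
  exact X.cubeMap_mem_openUnitCube hs hr x

/-- The change of variables preserves the integral over the cube. -/
lemma integral_term_one (hs : 1 ≤ s) (f : (Fin d → ℝ) → ℝ) :
    ∫ x, X.term 1 f (fun _ => X.density) x = ∫ x, f x ∂(cubeMeasure d) := by
  have h1 := integral_image_eq_integral_abs_det_fderiv_smul volume
    (measurableSet_openUnitCube (d := d))
    (fun x _ => (X.hasFDerivAt_cubeMap 1 x).hasFDerivWithinAt) (X.injOn_cubeMap one_ne_zero) f
  rw [X.image_cubeMap_one] at h1
  rw [cubeMeasure_eq_restrict_open, h1, ← integral_indicator measurableSet_openUnitCube]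
  apply integral_congr_ae
  filter_upwards with x
  by_cases hx : x ∈ openUnitCube d
  · rw [Set.indicator_of_mem hx, X.det_cubeMapDeriv, one_pow, one_mul,
      abs_of_nonneg (X.prod_density_nonneg x), smul_eq_mul, term, mul_comm]
  · rw [Set.indicator_of_notMem hx, term, X.prod_density_eq_zero hs hx, mul_zero]

/-- The square integral of a term is controlled by the square integral of the function. -/
lemma lintegral_term_sq_le (hs : 1 ≤ s) {b : Fin d → ℝ → ℝ} (hb : ∀ i, X.Vanishing s (b i)) :
    ∃ K : ℝ, 0 ≤ K ∧ ∀ (f : (Fin d → ℝ) → ℝ) (r : ℝ), r ∈ Set.Ioo (2⁻¹ : ℝ) 1 →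
      ∫⁻ x, ENNReal.ofReal (X.term r f b x ^ 2) ≤
        ENNReal.ofReal K * eLpNorm f 2 (cubeMeasure d) ^ 2 := by
  choose c hc0 hc using fun i => (hb i).sq_le X hs
  -- The product of the `b i ^ 2` is dominated by the Jacobian density; `2^d` bounds `r^(-d)` for `r
  -- > 1/2`, uniformly as `r → 1`.
  refine ⟨(∏ i, c i) * 2 ^ d, mul_nonneg (Finset.prod_nonneg fun i _ => hc0 i) (by positivity), ?_⟩
  intro f r hr
  have hr' : r ∈ Set.Ioo (0 : ℝ) 1 := ⟨by linarith [hr.1], hr.2⟩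
  have hcp : 0 ≤ ∏ i, c i := Finset.prod_nonneg fun i _ => hc0 i
  calc ∫⁻ x, ENNReal.ofReal (X.term r f b x ^ 2)
      ≤ ∫⁻ x, ENNReal.ofReal (∏ i, c i) *
          (ENNReal.ofReal (f (X.cubeMap r x) ^ 2) * ENNReal.ofReal (∏ i, X.density (x i))) := by
        apply lintegral_mono
        intro x
        beta_reduce
        rw [← ENNReal.ofReal_mul (sq_nonneg _), ← ENNReal.ofReal_mul hcp]
        apply ENNReal.ofReal_le_ofReal
        rw [term, mul_pow, mul_left_comm, ← Finset.prod_mul_distrib, ← Finset.prod_pow]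
        gcongr with i
        exact hc i (x i)
    _ = ENNReal.ofReal (∏ i, c i) *
          ∫⁻ x, ENNReal.ofReal (f (X.cubeMap r x) ^ 2) * ENNReal.ofReal (∏ i, X.density (x i)) :=
        lintegral_const_mul' _ _ ENNReal.ofReal_ne_top
    _ ≤ ENNReal.ofReal (∏ i, c i) * (ENNReal.ofReal (r ^ d)⁻¹ *
          ∫⁻ x, ENNReal.ofReal (f x ^ 2) ∂(cubeMeasure d)) := by
        gcongr
        exact X.lintegral_comp_cubeMap_le hs hr' fun y => ENNReal.ofReal (f y ^ 2)
    _ ≤ ENNReal.ofReal (∏ i, c i) * (ENNReal.ofReal (2 ^ d) *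
          ∫⁻ x, ENNReal.ofReal (f x ^ 2) ∂(cubeMeasure d)) := by
        gcongr
        rw [← inv_pow]
        have h0 := hr'.1
        have : r⁻¹ ≤ 2 := inv_le_of_inv_le₀ two_pos hr.1.le
        gcongr
    _ = _ := by
        rw [eLpNorm_two_sq, ENNReal.ofReal_mul hcp, mul_assoc]

/-- The change of variables is bounded on functions with bounded mixed derivatives. -/
theorem exists_sum_integral_mixedD_sq_le (hs : 1 ≤ s) :
    ∃ K : ℝ, 0 ≤ K ∧ ∀ (f : (Fin d → ℝ) → ℝ) (r : ℝ), r ∈ Set.Ioo (2⁻¹ : ℝ) 1 →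
      ContDiffOn ℝ ((s * d : ℕ) : WithTop ℕ∞) f (openUnitCube d) → mixNorm s f ≤ 1 →
      ∑ α ∈ Finset.Iic (fun _ : Fin d => s),
        ∫ x, mixedD α (X.term r f fun _ => X.density) x ^ 2 ≤ K := by
  have key : ∀ α : Fin d → ℕ, ∃ K : ℝ, 0 ≤ K ∧ ((∀ i, α i ≤ s) →
      ∀ (f : (Fin d → ℝ) → ℝ) (r : ℝ), r ∈ Set.Ioo (2⁻¹ : ℝ) 1 →
      ContDiffOn ℝ ((s * d : ℕ) : WithTop ℕ∞) f (openUnitCube d) → mixNorm s f ≤ 1 →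
      ∫ x, mixedD α (X.term r f fun _ => X.density) x ^ 2 ≤ K) := by
    intro α
    by_cases hα : ∀ i, α i ≤ s
    swap
    · exact ⟨0, le_rfl, fun h => absurd h hα⟩
    obtain ⟨ι, hι, e, β, b, hβ, -, hbv, hD⟩ :=
      exists_listD_term X hs (List.finRange d) (List.nodup_finRange d) α hα
    choose c hc0 hc using fun t => X.lintegral_term_sq_le hs (hbv t)
    have hK0 : 0 ≤ ∑ t, (Fintype.card ι : ℝ) * c t :=
      Finset.sum_nonneg fun t _ => mul_nonneg (Nat.cast_nonneg _) (hc0 t)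
    refine ⟨∑ t, (Fintype.card ι : ℝ) * c t, hK0, fun _ f r hr hf hnorm => ?_⟩
    have hr' : r ∈ Set.Ioo (0 : ℝ) 1 := ⟨by linarith [hr.1], hr.2⟩
    have hterm : ∀ t, Continuous (X.term r (mixedD (β t) f) (b t)) := by
      intro t
      apply ContDiff.continuous (𝕜 := ℝ) (n := ((0 : ℕ) : WithTop ℕ∞))
      refine contDiff_term hs hr' ?_ fun i => (hbv t i).contDiff
      rw [mixedD_eq_listD]
      apply contDiffOn_listD
      apply hf.of_le
      have : (0 + ((List.finRange d).map (β t)).sum) ≤ s * d := by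
        rw [zero_add, sum_map_finRange]
        calc ∑ i, β t i ≤ ∑ _i : Fin d, s := Finset.sum_le_sum fun i _ => hβ t i
          _ = s * d := by simp [mul_comm]
      exact_mod_cast this
    have hcont : Continuous fun x => mixedD α (X.term r f fun _ => X.density) x := by
      rw [mixedD_eq_listD, hD f r hr' hf]
      exact continuous_finsetSum _ fun t _ => continuous_const.mul (hterm t)
    rw [integral_eq_lintegral_of_nonneg_ae (Filter.Eventually.of_forall fun x => sq_nonneg _)
      (hcont.pow 2).aestronglyMeasurable]
    apply ENNReal.toReal_le_of_le_ofReal hK0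
    -- Cauchy-Schwarz over the finite index set, whose size depends neither on `f` nor on `r`; the
    -- powers of `r` are at most 1.
    calc ∫⁻ x, ENNReal.ofReal (mixedD α (X.term r f fun _ => X.density) x ^ 2)
        ≤ ∫⁻ x, ∑ t, (Fintype.card ι : ℝ≥0∞) *
            ENNReal.ofReal (X.term r (mixedD (β t) f) (b t) x ^ 2) := by
          apply lintegral_mono
          intro x
          beta_reduce
          rw [mixedD_eq_listD, hD f r hr' hf, ← Finset.mul_sum,
            ← ENNReal.ofReal_sum_of_nonneg fun _ _ => sq_nonneg _, ← ENNReal.ofReal_natCast,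
            ← ENNReal.ofReal_mul (Nat.cast_nonneg _)]
          apply ENNReal.ofReal_le_ofReal
          refine sq_sum_le_card_mul_sum_sq.trans ?_
          rw [Finset.card_univ]
          refine mul_le_mul_of_nonneg_left (Finset.sum_le_sum fun t _ => ?_) (Nat.cast_nonneg _)
          rw [mul_pow, mixedD_eq_listD]
          apply mul_le_of_le_one_left (sq_nonneg _)
          exact pow_le_one₀ (by have := hr'.1; positivity) (pow_le_one₀ hr'.1.le hr'.2.le)
      _ = ∑ t, (Fintype.card ι : ℝ≥0∞) *
            ∫⁻ x, ENNReal.ofReal (X.term r (mixedD (β t) f) (b t) x ^ 2) := by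
          rw [lintegral_finsetSum]
          · apply Finset.sum_congr rfl
            intro t _
            exact lintegral_const_mul' _ _ (ENNReal.natCast_ne_top _)
          · intro t _
            exact (((hterm t).pow 2).measurable.ennreal_ofReal).const_mul _
      _ ≤ ∑ t, (Fintype.card ι : ℝ≥0∞) * ENNReal.ofReal (c t) := by
          gcongr with t
          refine (hc t (mixedD (β t) f) r hr).trans ?_
          apply mul_le_of_le_one_right zero_le
          have h1 := sum_eLpNorm_sq_le_of_mixNormOfFamily_le (α := β t) hnorm
            (Finset.mem_Iic.2 fun i => hβ t i)
          simpa using h1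
      _ = _ := by
          rw [ENNReal.ofReal_sum_of_nonneg fun t _ => mul_nonneg (Nat.cast_nonneg _) (hc0 t)]
          apply Finset.sum_congr rfl
          intro t _
          rw [ENNReal.ofReal_mul (Nat.cast_nonneg _), ENNReal.ofReal_natCast]
  choose K hK0 hK using key
  refine ⟨∑ α ∈ Finset.Iic (fun _ : Fin d => s), K α, Finset.sum_nonneg fun α _ => hK0 α, ?_⟩
  intro f r hr hf hnorm
  exact Finset.sum_le_sum fun α hα => hK α (Finset.mem_Iic.1 hα) f r hr hf hnorm

end CoordChange

/-! ### From smooth functions to the whole class -/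

section MixClass

variable {d s : ℕ} {f g : (Fin d → ℝ) → ℝ}

lemma isCompact_unitCube : IsCompact (unitCube d) := isCompact_Icc

lemma integrable_cubeMeasure (hf : ContinuousOn f (unitCube d)) :
    Integrable f (cubeMeasure d) := hf.integrableOn_compact isCompact_unitCube

lemma mixedD_zero : mixedD (fun _ => 0) f = f := by
  have h : ∀ l : List (Fin d), listD l (fun _ => 0) f = f := by
    intro l
    induction l with
    | nil => rfl
    | cons i l ih => exact ih
  exact h _

/-- A weak derivative of order zero is the function itself. -/
lemma IsWeakMixedD.ae_eq (hf : ContinuousOn f (unitCube d)) (h : IsWeakMixedD (fun _ => 0) f g) :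
    f =ᵐ[cubeMeasure d] g := by
  have hfi := integrable_cubeMeasure hf
  have hgi : Integrable g (cubeMeasure d) := h.1.integrable one_le_two
  -- Fundamental lemma of the calculus of variations: the difference integrates to zero against
  -- every test function.
  have hae := isOpen_openUnitCube.ae_eq_zero_of_integral_contDiff_smul_eq_zero
    (μ := cubeMeasure d) (f := fun x => f x - g x)
    ((hfi.sub hgi).locallyIntegrable.locallyIntegrableOn _) (by
      intro φ hφ hφs hφU
      have h1 := h.2 φ hφ hφs hφU
      rw [mixedD_zero] at h1
      obtain ⟨c, hc⟩ := hφs.exists_bound_of_continuous hφ.continuous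
      have hi : ∀ u : (Fin d → ℝ) → ℝ, Integrable u (cubeMeasure d) →
          Integrable (fun x => u x * φ x) (cubeMeasure d) := fun u hu =>
        hu.mul_bdd hφ.continuous.aestronglyMeasurable (Filter.Eventually.of_forall hc)
      simp only [smul_eq_mul, mul_comm (φ _), sub_mul]
      rw [integral_sub (hi f hfi) (hi g hgi), h1]
      simp)
  have hopen : ∀ᵐ x ∂(cubeMeasure d), x ∈ openUnitCube d := by
    rw [cubeMeasure_eq_restrict_open]
    exact ae_restrict_mem measurableSet_openUnitCube
  filter_upwards [hae, hopen] with x hx hxo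
  exact sub_eq_zero.1 (hx hxo)

lemma integral_abs_le_of_eLpNorm_le {ε : ℝ} (hε : 0 ≤ ε)
    (hf : AEStronglyMeasurable f (cubeMeasure d))
    (h : eLpNorm f 2 (cubeMeasure d) ≤ ENNReal.ofReal ε) :
    ∫ x, |f x| ∂(cubeMeasure d) ≤ ε := by
  rw [integral_eq_lintegral_of_nonneg_ae
    (Filter.Eventually.of_forall fun x => abs_nonneg _) hf.norm]
  apply ENNReal.toReal_le_of_le_ofReal hε
  refine le_trans (le_of_eq ?_) ((eLpNorm_le_eLpNorm_of_exponent_le one_le_two hf).trans h)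
  rw [eLpNorm_one_eq_lintegral_enorm]
  apply lintegral_congr
  intro x
  rw [Real.enorm_eq_ofReal_abs]

lemma continuousOn_of_mem_smoothMixBall (hg : g ∈ smoothMixBall d s) :
    ContinuousOn g (unitCube d) := hg.1.continuousOn

/-- Functions in the class are limits in `L₁` of functions in the smooth unit ball. -/
lemma exists_mem_smoothMixBall_integral_abs_sub_le (hf : f ∈ mixClass d s) {ε : ℝ} (hε : 0 < ε) :
    ∃ g ∈ smoothMixBall d s, ∫ x, |f x - g x| ∂(cubeMeasure d) ≤ ε := by
  obtain ⟨hfc, F, hF, happ⟩ := hf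
  have h0 : (fun _ => 0 : Fin d → ℕ) ∈ Finset.Iic (fun _ : Fin d => s) :=
    Finset.mem_Iic.2 fun _ => Nat.zero_le _
  have hae := (hF _ h0).ae_eq hfc
  obtain ⟨g, hg, hgε⟩ := happ (ENNReal.ofReal ε) (ENNReal.ofReal_pos.2 hε)
  refine ⟨g, hg, ?_⟩
  have h1 := sum_eLpNorm_sq_le_of_mixNormOfFamily_le hgε.le h0
  have h2 := (ENNReal.pow_le_pow_left_iff two_ne_zero).1 h1
  rw [mixedD_zero] at h2
  apply integral_abs_le_of_eLpNorm_le hε.le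
  · exact (integrable_cubeMeasure (hfc.sub
      (continuousOn_of_mem_smoothMixBall hg))).aestronglyMeasurable
  · refine le_trans (le_of_eq (eLpNorm_congr_ae ?_)) h2
    filter_upwards [hae] with x hx
    rw [hx]

/-- A function of the smooth ball at `L₁` distance at most 1 has `L₁` norm at most 1. Any uniform
bound would do: it serves for small `n`, where the zero formula is used. -/
lemma abs_integral_le_two (hf : f ∈ mixClass d s) : |∫ x, f x ∂(cubeMeasure d)| ≤ 2 := by
  obtain ⟨g, hg, hfg⟩ := exists_mem_smoothMixBall_integral_abs_sub_le hf one_pos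
  have hfi := integrable_cubeMeasure hf.1
  have hgi := integrable_cubeMeasure (continuousOn_of_mem_smoothMixBall hg)
  have h0 : (fun _ => 0 : Fin d → ℕ) ∈ Finset.Iic (fun _ : Fin d => s) :=
    Finset.mem_Iic.2 fun _ => Nat.zero_le _
  have h1 := sum_eLpNorm_sq_le_of_mixNormOfFamily_le hg.2 h0
  have h2 := (ENNReal.pow_le_pow_left_iff two_ne_zero).1 h1
  rw [mixedD_zero] at h2
  have h3 : ∫ x, |g x| ∂(cubeMeasure d) ≤ 1 :=
    integral_abs_le_of_eLpNorm_le zero_le_one hgi.aestronglyMeasurable (by simpa using h2)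
  calc |∫ x, f x ∂(cubeMeasure d)| ≤ ∫ x, |f x| ∂(cubeMeasure d) := abs_integral_le_integral_abs
    _ ≤ ∫ x, (|f x - g x| + |g x|) ∂(cubeMeasure d) := by
      apply integral_mono hfi.abs ((hfi.sub hgi).abs.add hgi.abs)
      intro x
      have := abs_add_le (f x - g x) (g x)
      simpa using this
    _ = ∫ x, |f x - g x| ∂(cubeMeasure d) + ∫ x, |g x| ∂(cubeMeasure d) :=
      integral_add (hfi.sub hgi).abs hgi.abs
    _ ≤ 2 := by linarith

end MixClass

namespace CoordChange

variable {s d : ℕ} (X : CoordChange s) {f g : (Fin d → ℝ) → ℝ}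

lemma cubeMap_mem_unitCube (hs : 1 ≤ s) {r : ℝ} (hr : r ∈ Set.Ioc (0 : ℝ) 1) (x : Fin d → ℝ) :
    X.cubeMap r x ∈ unitCube d := by
  rcases eq_or_lt_of_le hr.2 with h | h
  · rw [h]
    exact X.cubeMap_one_mem_unitCube hs x
  · exact openUnitCube_subset_unitCube (X.cubeMap_mem_openUnitCube hs ⟨hr.1, h⟩ x)

lemma continuous_prod_density : Continuous fun x : Fin d → ℝ => ∏ i, X.density (x i) :=
  continuous_finsetProd _ fun i _ => X.contDiff_density.continuous.comp (continuous_apply i)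

lemma continuous_term (hs : 1 ≤ s) (hf : ContinuousOn f (unitCube d)) {r : ℝ}
    (hr : r ∈ Set.Ioc (0 : ℝ) 1) : Continuous (X.term r f fun _ => X.density) :=
  (hf.comp_continuous (X.contDiff_cubeMap r).continuous (X.cubeMap_mem_unitCube hs hr)).mul
    X.continuous_prod_density

lemma tsupport_term_subset (hs : 1 ≤ s) (f : (Fin d → ℝ) → ℝ) (r : ℝ) :
    tsupport (X.term r f fun _ => X.density) ⊆ unitCube d := by
  apply closure_minimal _ isClosed_Icc
  intro x hx
  by_contra h
  apply hx
  rw [term, X.prod_density_eq_zero hs fun h' => h (openUnitCube_subset_unitCube h'), mul_zero]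

lemma hasCompactSupport_term (hs : 1 ≤ s) (f : (Fin d → ℝ) → ℝ) (r : ℝ) :
    HasCompactSupport (X.term r f fun _ => X.density) :=
  isCompact_unitCube.of_isClosed_subset (isClosed_tsupport _) (X.tsupport_term_subset hs f r)

lemma hasCompactSupport_prod_density (hs : 1 ≤ s) :
    HasCompactSupport fun x : Fin d → ℝ => ∏ i, X.density (x i) := by
  have h : (fun x : Fin d → ℝ => ∏ i, X.density (x i)) =
      X.term 1 (fun _ => 1) fun _ => X.density := by
    ext x
    rw [term, one_mul]
  rw [h]
  exact X.hasCompactSupport_term hs _ _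

variable {M N : Matrix (Fin d) (Fin d) ℝ}

-- Dominated convergence: the values of `f` are bounded on the cube and the density factor does not
-- depend on `r`.
open Matrix in
lemma tendsto_intFourier_term (hs : 1 ≤ s) (hMN : M * N = 1) (hf : ContinuousOn f (unitCube d))
    {r : ℕ → ℝ} (hr : ∀ n, r n ∈ Set.Ioc (0 : ℝ) 1)
    (hr1 : Filter.Tendsto r Filter.atTop (nhds 1)) (k : Fin d → ℤ) :
    Filter.Tendsto (fun n => intFourier (fun t => X.term (r n) f (fun _ => X.density) (M *ᵥ t)) k)
      Filter.atTop (nhds (intFourier (fun t => X.term 1 f (fun _ => X.density) (M *ᵥ t)) k)) := by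
  obtain ⟨c, hc⟩ := isCompact_unitCube.exists_bound_of_continuousOn hf
  have hcM : Continuous fun t : Fin d → ℝ => M *ᵥ t := by fun_prop
  have hE : Continuous fun t : Fin d → ℝ => UnitAddTorus.mFourier (-k) (toTorus t) :=
    (UnitAddTorus.mFourier (-k)).continuous.comp continuous_toTorus
  have hNM : N * M = 1 := mul_eq_one_comm.1 hMN
  have hint : Integrable fun t : Fin d → ℝ => ∏ i, X.density ((M *ᵥ t) i) :=
    Continuous.integrable_of_hasCompactSupport (X.continuous_prod_density.comp hcM)
      (hasCompactSupport_comp_mulVec (g := fun x => ∏ i, X.density (x i)) hNM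
        (X.hasCompactSupport_prod_density hs))
  apply tendsto_integral_of_dominated_convergence fun t => c * ∏ i, X.density ((M *ᵥ t) i)
  · intro n
    exact (hE.mul (Complex.continuous_ofReal.comp
      ((X.continuous_term hs hf (hr n)).comp hcM))).aestronglyMeasurable
  · exact hint.const_mul c
  · intro n
    filter_upwards with t
    have h1 : ‖UnitAddTorus.mFourier (-k) (toTorus t)‖ ≤ 1 :=
      ((UnitAddTorus.mFourier (-k)).norm_coe_le_norm _).trans UnitAddTorus.mFourier_norm.le
    rw [norm_mul, Complex.norm_real]
    refine (mul_le_of_le_one_left (norm_nonneg _) h1).trans ?_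
    rw [term, norm_mul, Real.norm_of_nonneg (X.prod_density_nonneg _)]
    exact mul_le_mul_of_nonneg_right (hc _ (X.cubeMap_mem_unitCube hs (hr n) _))
      (X.prod_density_nonneg _)
  · filter_upwards with t
    apply Filter.Tendsto.const_mul
    apply (Complex.continuous_ofReal.tendsto _).comp
    apply Filter.Tendsto.mul_const
    have h1 := hf _ (X.cubeMap_one_mem_unitCube hs (M *ᵥ t))
    apply h1.tendsto.comp
    apply tendsto_nhdsWithin_of_tendsto_nhds_of_eventually_within
    · rw [tendsto_pi_nhds]
      intro i
      simp only [cubeMap]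
      exact ((hr1.const_sub 1).div_const 2).add (hr1.mul_const _)
    · exact Filter.Eventually.of_forall fun n => X.cubeMap_mem_unitCube hs (hr n) _

-- Characters have modulus 1 and the substitution preserves the integral of `|f - g|`, so `L₁`
-- convergence is enough for convergence of each coefficient.
open Matrix in
lemma norm_intFourier_term_sub_le (hs : 1 ≤ s) (hM : M.det ≠ 0) (hMN : M * N = 1)
    (hf : ContinuousOn f (unitCube d)) (hg : ContinuousOn g (unitCube d)) (k : Fin d → ℤ) :
    ‖intFourier (fun t => X.term 1 f (fun _ => X.density) (M *ᵥ t)) k -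
      intFourier (fun t => X.term 1 g (fun _ => X.density) (M *ᵥ t)) k‖ ≤
      |M.det|⁻¹ * ∫ x, |f x - g x| ∂(cubeMeasure d) := by
  have hNM : N * M = 1 := mul_eq_one_comm.1 hMN
  have hcM : Continuous fun t : Fin d → ℝ => M *ᵥ t := by fun_prop
  have hE : Continuous fun t : Fin d → ℝ => UnitAddTorus.mFourier (-k) (toTorus t) :=
    (UnitAddTorus.mFourier (-k)).continuous.comp continuous_toTorus
  have h1 : (1 : ℝ) ∈ Set.Ioc (0 : ℝ) 1 := ⟨zero_lt_one, le_rfl⟩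
  have hint : ∀ u : (Fin d → ℝ) → ℝ, ContinuousOn u (unitCube d) → Integrable fun t =>
      UnitAddTorus.mFourier (-k) (toTorus t) *
        (X.term 1 u (fun _ => X.density) (M *ᵥ t) : ℂ) := by
    intro u hu
    apply (hE.mul (Complex.continuous_ofReal.comp
      ((X.continuous_term hs hu h1).comp hcM))).integrable_of_hasCompactSupport
    apply HasCompactSupport.mul_left
    exact (hasCompactSupport_comp_mulVec hNM (X.hasCompactSupport_term hs u 1)).comp_left
      Complex.ofReal_zero
  have hfg : ContinuousOn (fun x => |f x - g x|) (unitCube d) := (hf.sub hg).abs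
  rw [intFourier, intFourier, ← integral_sub (hint f hf) (hint g hg),
    ← X.integral_term_one hs, ← integral_comp_mulVec hM (X.continuous_term hs hfg h1)]
  refine (norm_integral_le_integral_norm _).trans (le_of_eq ?_)
  apply integral_congr_ae
  filter_upwards with t
  have h2 : ‖UnitAddTorus.mFourier (-k) (toTorus t)‖ = 1 := by
    rw [mFourier_toTorus, Complex.norm_exp]
    simp [Complex.mul_re, Complex.mul_im]
  rw [← mul_sub, norm_mul, h2, one_mul, ← Complex.ofReal_sub, Complex.norm_real, Real.norm_eq_abs]
  simp only [term]
  rw [← sub_mul, abs_mul, abs_of_nonneg (X.prod_density_nonneg _)]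

open Matrix in
/-- The weighted Fourier coefficients of the transformed functions in the class are uniformly
square summable. -/
theorem exists_sum_mixWeight_term_le (hs : 1 ≤ s) :
    ∃ K : ℝ, 0 ≤ K ∧ ∀ (M N : Matrix (Fin d) (Fin d) ℝ), M * N = 1 → ∀ K₀ : ℝ,
      (∀ t, {m | M *ᵥ (t + intVec m) ∈ unitCube d}.Finite ∧
        ({m | M *ᵥ (t + intVec m) ∈ unitCube d}.ncard : ℝ) ≤ K₀) →
      ∀ f ∈ mixClass d s, ∀ T : Finset (Fin d → ℤ),
        ∑ k ∈ T, mixWeight s (Nᵀ *ᵥ intVec k) *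
          ‖intFourier (fun t => X.term 1 f (fun _ => X.density) (M *ᵥ t)) k‖ ^ 2 ≤
            K₀ * |M.det|⁻¹ * K := by
  obtain ⟨K, hK0, hK⟩ := X.exists_sum_integral_mixedD_sq_le (d := d) hs
  refine ⟨K, hK0, ?_⟩
  intro M N hMN K₀ hK₀ f hf T
  have hK₀0 : 0 ≤ K₀ := (Nat.cast_nonneg _).trans (hK₀ 0).2
  have hdet : M.det ≠ 0 := by
    intro h
    have := congrArg Matrix.det hMN
    rw [Matrix.det_mul, h] at this
    simp at this
  have hsmooth : ∀ g ∈ smoothMixBall d s,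
      ∑ k ∈ T, mixWeight s (Nᵀ *ᵥ intVec k) *
          ‖intFourier (fun t => X.term 1 g (fun _ => X.density) (M *ᵥ t)) k‖ ^ 2 ≤
            K₀ * |M.det|⁻¹ * K := by
    intro g hg
    have hgo : ContDiffOn ℝ ((s * d : ℕ) : WithTop ℕ∞) g (openUnitCube d) :=
      hg.1.mono openUnitCube_subset_unitCube
    -- The shift by 3 keeps `r n ≥ 2/3`, inside the range where the bound is uniform.
    set r : ℕ → ℝ := fun n => 1 - 1 / ((n : ℝ) + 3) with hrdef
    have hr : ∀ n, r n ∈ Set.Ioo (2⁻¹ : ℝ) 1 := by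
      intro n
      have h3 : (0 : ℝ) < n + 3 := by positivity
      have h4 : 1 / ((n : ℝ) + 3) ≤ 1 / 3 := by
        apply one_div_le_one_div_of_le (by norm_num)
        have : (0 : ℝ) ≤ n := Nat.cast_nonneg n
        linarith
      have h5 : 0 < 1 / ((n : ℝ) + 3) := by positivity
      simp only [hrdef]
      constructor
      · norm_num at h4 ⊢
        linarith
      · linarith
    have hr' : ∀ n, r n ∈ Set.Ioc (0 : ℝ) 1 := fun n =>
      ⟨by linarith [(hr n).1], (hr n).2.le⟩
    have hr1 : Filter.Tendsto r Filter.atTop (nhds 1) := by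
      have h3 : Filter.Tendsto (fun n : ℕ => (n : ℝ) + 3) Filter.atTop Filter.atTop :=
        Filter.tendsto_atTop_add_const_right _ _ tendsto_natCast_atTop_atTop
      have h4 := (h3.inv_tendsto_atTop).const_sub 1
      simp only [sub_zero] at h4
      simpa [hrdef] using h4
    have hlim : Filter.Tendsto (fun n => ∑ k ∈ T, mixWeight s (Nᵀ *ᵥ intVec k) *
        ‖intFourier (fun t => X.term (r n) g (fun _ => X.density) (M *ᵥ t)) k‖ ^ 2) Filter.atTop
        (nhds (∑ k ∈ T, mixWeight s (Nᵀ *ᵥ intVec k) *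
          ‖intFourier (fun t => X.term 1 g (fun _ => X.density) (M *ᵥ t)) k‖ ^ 2)) := by
      apply tendsto_finsetSum
      intro k _
      exact ((X.tendsto_intFourier_term hs hMN (continuousOn_of_mem_smoothMixBall hg)
        hr' hr1 k).norm.pow 2).const_mul _
    refine le_of_tendsto hlim (Filter.Eventually.of_forall fun n => ?_)
    have hr0 : r n ∈ Set.Ioo (0 : ℝ) 1 := ⟨(hr' n).1, (hr n).2⟩
    have hsub : ∀ t, {m | M *ᵥ (t + intVec m) ∈ tsupport (X.term (r n) g fun _ => X.density)} ⊆
        {m | M *ᵥ (t + intVec m) ∈ unitCube d} := fun t m hm => X.tsupport_term_subset hs g _ hm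
    refine (sum_mixWeight_intFourier_le hMN
      (contDiff_term hs hr0 hgo fun _ => X.contDiff_density) (X.hasCompactSupport_term hs g _)
      (K := K₀) (fun t => (hK₀ t).1.subset (hsub t)) (fun t => ?_) T).trans ?_
    · refine le_trans ?_ (hK₀ t).2
      exact_mod_cast Set.ncard_le_ncard (hsub t) (hK₀ t).1
    · apply mul_le_mul_of_nonneg_left (hK g (r n) (hr n) hgo hg.2)
      exact mul_nonneg hK₀0 (inv_nonneg.2 (abs_nonneg _))
  -- Second limit: the bound for smooth functions is uniform, and only finitely many coefficients
  -- are involved.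
  choose g hg hfg using fun n : ℕ =>
    exists_mem_smoothMixBall_integral_abs_sub_le hf (ε := 1 / ((n : ℝ) + 1)) (by positivity)
  have hcoef : ∀ k, Filter.Tendsto
      (fun n => intFourier (fun t => X.term 1 (g n) (fun _ => X.density) (M *ᵥ t)) k) Filter.atTop
      (nhds (intFourier (fun t => X.term 1 f (fun _ => X.density) (M *ᵥ t)) k)) := by
    intro k
    rw [tendsto_iff_norm_sub_tendsto_zero]
    have h1 : Filter.Tendsto (fun n : ℕ => |M.det|⁻¹ * (1 / ((n : ℝ) + 1))) Filter.atTop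
        (nhds 0) := by
      have := (tendsto_one_div_add_atTop_nhds_zero_nat (𝕜 := ℝ)).const_mul |M.det|⁻¹
      rwa [mul_zero] at this
    refine squeeze_zero (fun n => norm_nonneg _) (fun n => ?_) h1
    rw [norm_sub_rev]
    refine (X.norm_intFourier_term_sub_le hs hdet hMN hf.1
      (continuousOn_of_mem_smoothMixBall (hg n)) k).trans ?_
    exact mul_le_mul_of_nonneg_left (hfg n) (inv_nonneg.2 (abs_nonneg _))
  have hlim : Filter.Tendsto (fun n => ∑ k ∈ T, mixWeight s (Nᵀ *ᵥ intVec k) *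
      ‖intFourier (fun t => X.term 1 (g n) (fun _ => X.density) (M *ᵥ t)) k‖ ^ 2) Filter.atTop
      (nhds (∑ k ∈ T, mixWeight s (Nᵀ *ᵥ intVec k) *
        ‖intFourier (fun t => X.term 1 f (fun _ => X.density) (M *ᵥ t)) k‖ ^ 2)) := by
    apply tendsto_finsetSum
    intro k _
    exact ((hcoef k).norm.pow 2).const_mul _
  exact le_of_tendsto hlim (Filter.Eventually.of_forall fun n => hsmooth (g n) (hg n))

end CoordChange

/-! ### The cubature formula and its error -/

/-- A weighted sum of at most `n` function values is a cubature formula with `n` nodes. -/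
lemma exists_cubature_of_finset {d n : ℕ} {ι : Type*} (S : Finset ι) (hS : S.card ≤ n)
    (node : ι → Fin d → ℝ) (hnode : ∀ i ∈ S, node i ∈ unitCube d) (weight : ι → ℝ) :
    ∃ Q : Cubature d n, ∀ f, Q.apply f = ∑ i ∈ S, weight i * f (node i) := by
  classical
  obtain ⟨e⟩ : Nonempty (S ↪ Fin n) :=
    Function.Embedding.nonempty_of_card_le (by simpa using hS)
  -- Unused slots are filled with the origin and weight zero.
  refine ⟨⟨Function.extend e (fun i => node i) 0, ?_, Function.extend e (fun i => weight i) 0⟩, ?_⟩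
  · intro j
    by_cases hj : ∃ i, e i = j
    · obtain ⟨i, rfl⟩ := hj
      rw [e.injective.extend_apply]
      exact hnode i i.2
    · rw [Function.extend_apply' _ _ _ hj]
      exact ⟨le_rfl, zero_le_one⟩
  · intro f
    rw [Cubature.apply, ← Finset.sum_coe_sort S fun i => weight i * f (node i)]
    symm
    apply Finset.sum_of_injOn (s := Finset.univ) e e.injective.injOn
      (fun _ _ => Finset.mem_coe.2 (Finset.mem_univ _))
    · intro j _ hj
      have hj' : ¬∃ i, e i = j := by simpa using hj
      simp only [Function.extend_apply' _ _ _ hj', Pi.zero_apply, zero_mul]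
    · intro i _
      simp only [e.injective.extend_apply]

open Matrix in
/-- The number of points of a shifted lattice in the unit cube. -/
lemma ncard_lattice_unitCube_le {d : ℕ} {M N : Matrix (Fin d) (Fin d) ℝ} (hMN : M * N = 1) {c : ℝ}
    (hc : 0 ≤ c) (hN : ∀ i, ∑ j, |N i j| ≤ c) (t : Fin d → ℝ) :
    {m | M *ᵥ (t + intVec m) ∈ unitCube d}.Finite ∧
      ({m | M *ᵥ (t + intVec m) ∈ unitCube d}.ncard : ℝ) ≤ (2 * c + 1) ^ d := by
  have hNM : N * M = 1 := mul_eq_one_comm.1 hMN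
  set S := Fintype.piFinset fun i => Finset.Icc ⌈-c - t i⌉ ⌊c - t i⌋ with hS
  have hsub : {m | M *ᵥ (t + intVec m) ∈ unitCube d} ⊆ (S : Set (Fin d → ℤ)) := by
    intro m hm
    have h1 : t + intVec m = N *ᵥ (M *ᵥ (t + intVec m)) := by
      rw [Matrix.mulVec_mulVec, hNM, Matrix.one_mulVec]
    rw [Finset.mem_coe, hS, Fintype.mem_piFinset]
    intro i
    -- Here `t + m` is `N` applied to a point of the cube, so it is bounded by the absolute row sums
    -- of `N`; an interval of length `2 c` contains at most `2 c + 1` integers.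
    have h2 : |t i + m i| ≤ c := by
      have h3 := congrFun h1 i
      simp only [Pi.add_apply, intVec_apply] at h3
      rw [h3]
      refine le_trans ?_ (hN i)
      simp only [Matrix.mulVec, dotProduct]
      refine (Finset.abs_sum_le_sum_abs _ _).trans (Finset.sum_le_sum fun j _ => ?_)
      rw [abs_mul]
      apply mul_le_of_le_one_right (abs_nonneg _)
      have h4 := hm.1 j
      have h5 := hm.2 j
      rw [abs_le]
      simp only [Pi.zero_apply, Pi.one_apply] at h4 h5
      exact ⟨le_trans (by norm_num) h4, h5⟩
    have h6 := abs_le.1 h2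
    rw [Finset.mem_Icc]
    exact ⟨Int.ceil_le.2 (by linarith), Int.le_floor.2 (by linarith)⟩
  refine ⟨S.finite_toSet.subset hsub, ?_⟩
  have h1 : (({m | M *ᵥ (t + intVec m) ∈ unitCube d}.ncard : ℕ) : ℝ) ≤ S.card := by
    have := Set.ncard_le_ncard hsub S.finite_toSet
    rw [Set.ncard_coe_finset] at this
    exact_mod_cast this
  refine h1.trans ?_
  rw [hS, Fintype.card_piFinset, Nat.cast_prod]
  calc ∏ i, ((Finset.Icc ⌈-c - t i⌉ ⌊c - t i⌋).card : ℝ) ≤ ∏ _i : Fin d, (2 * c + 1) := by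
        apply Finset.prod_le_prod (fun _ _ => Nat.cast_nonneg _)
        intro i _
        rw [Int.card_Icc]
        have h2 := Int.floor_le (c - t i)
        have h3 := Int.le_ceil (-c - t i)
        have h4 : (((⌊c - t i⌋ + 1 - ⌈-c - t i⌉).toNat : ℤ) : ℝ) =
            max ((⌊c - t i⌋ : ℝ) + 1 - ⌈-c - t i⌉) 0 := by
          rw [Int.toNat_eq_max]
          push_cast
          rfl
        have h5 : (((⌊c - t i⌋ + 1 - ⌈-c - t i⌉).toNat : ℕ) : ℝ) =
            (((⌊c - t i⌋ + 1 - ⌈-c - t i⌉).toNat : ℤ) : ℝ) := by norm_cast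
        rw [h5, h4]
        apply max_le <;> linarith
    _ = _ := by simp

open Matrix in
/-- The error of the transformed lattice rule. -/
lemma sq_lattice_error_le {d s : ℕ} (hs : 1 ≤ s) (X : CoordChange s)
    {M N : Matrix (Fin d) (Fin d) ℝ} (hMN : M * N = 1) {f : (Fin d → ℝ) → ℝ}
    (hf : ContinuousOn f (unitCube d)) (S : Finset (Fin d → ℤ))
    (hS : ∀ m, M *ᵥ intVec m ∈ unitCube d → m ∈ S) {W V : ℝ} (hW : 0 ≤ W)
    (hsum : ∑' k : Fin d → ℤ, (if k = 0 then 0 else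
      ENNReal.ofReal (mixWeight s (Nᵀ *ᵥ intVec k))⁻¹) ≤ ENNReal.ofReal W)
    (hV : ∀ T : Finset (Fin d → ℤ), ∑ k ∈ T, mixWeight s (Nᵀ *ᵥ intVec k) *
      ‖intFourier (fun t => X.term 1 f (fun _ => X.density) (M *ᵥ t)) k‖ ^ 2 ≤ V) :
    (∫ x, f x ∂(cubeMeasure d) - ∑ m ∈ S, |M.det| *
      (∏ i, X.density ((M *ᵥ intVec m) i)) * f (X.cubeMap 1 (M *ᵥ intVec m))) ^ 2 ≤
      |M.det| ^ 2 * (W * V) := by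
  have hNM : N * M = 1 := mul_eq_one_comm.1 hMN
  have hdet : M.det ≠ 0 := by
    intro h
    have := congrArg Matrix.det hMN
    rw [Matrix.det_mul, h] at this
    simp at this
  have hcM : Continuous fun t : Fin d → ℝ => M *ᵥ t := by fun_prop
  have hct := X.continuous_term hs hf ⟨zero_lt_one, le_rfl⟩
  have h1 := sq_tsum_sub_integral_le (hct.comp hcM)
    (hasCompactSupport_comp_mulVec hNM (X.hasCompactSupport_term hs f 1))
    (fun k => mixWeight s (Nᵀ *ᵥ intVec k)) (fun k => mixWeight_pos _ _) hW hsum hV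
  -- The transformed integrand vanishes off the cube, so the lattice sum is a finite one over `S`.
  have h2 : ∑' m, X.term 1 f (fun _ => X.density) (M *ᵥ intVec m) =
      ∑ m ∈ S, X.term 1 f (fun _ => X.density) (M *ᵥ intVec m) := by
    apply tsum_eq_sum
    intro m hm
    by_contra h
    exact hm (hS m (X.tsupport_term_subset hs f 1 (subset_tsupport _ h)))
  have h3 := integral_comp_mulVec hdet hct
  rw [X.integral_term_one hs] at h3
  simp only [Function.comp_apply] at h1
  rw [h2, h3] at h1
  have hdp : 0 < |M.det| := abs_pos.2 hdet
  calc _ = |M.det| ^ 2 * (∑ m ∈ S, X.term 1 f (fun _ => X.density) (M *ᵥ intVec m) -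
        |M.det|⁻¹ * ∫ x, f x ∂(cubeMeasure d)) ^ 2 := by
        rw [← mul_pow, mul_sub, ← mul_assoc, mul_inv_cancel₀ hdp.ne', one_mul, Finset.mul_sum,
          ← neg_sq, neg_sub]
        congr 2
        apply Finset.sum_congr rfl
        intro m _
        rw [CoordChange.term]
        ring
    _ ≤ _ := mul_le_mul_of_nonneg_left h1 (sq_nonneg _)

open Matrix in
/-- Frolov's cubature formula with a parameter `R`, which is the inverse of the mesh size. -/
theorem exists_cubature_sq_error_le {d s : ℕ} (hd : 1 ≤ d) (hs : 1 ≤ s) :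
    ∃ L C : ℝ, 1 ≤ L ∧ 0 ≤ C ∧ ∀ (n : ℕ) (R : ℝ), 1 ≤ R → (L * R) ^ d ≤ n →
      ∃ Q : Cubature d n, ∀ f ∈ mixClass d s,
        (∫ x, f x ∂(cubeMeasure d) - Q.apply f) ^ 2 ≤
          C * (R ^ (2 * s * d))⁻¹ * (1 + Real.log R) ^ (d - 1) := by
  obtain ⟨B, hBdet, hB⟩ := exists_admissible_matrix d hd
  obtain ⟨C, hC, hsum⟩ := exists_tsum_inv_mixWeight_le hd hs B hB
  obtain ⟨X⟩ := nonempty_coordChange (s := s)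
  obtain ⟨K, hK0, hK⟩ := X.exists_sum_mixWeight_term_le (d := d) hs
  set b : ℝ := ∑ i, ∑ j, |B j i| with hb
  have hb0 : 0 ≤ b := Finset.sum_nonneg fun _ _ => Finset.sum_nonneg fun _ _ => abs_nonneg _
  have hbi : ∀ i, ∑ j, |B j i| ≤ b := fun i =>
    Finset.single_le_sum (f := fun i => ∑ j, |B j i|)
      (fun _ _ => Finset.sum_nonneg fun _ _ => abs_nonneg _) (Finset.mem_univ i)
  refine ⟨2 * b + 1, |B.det|⁻¹ * C * (2 * b + 1) ^ d * K, by linarith, by positivity, ?_⟩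
  intro n R hR hn
  have hRpos : 0 < R := by linarith
  -- With `M = N⁻¹` the node lattice is `M ℤ^d`, and its dual `Nᵀ ℤ^d` is the admissible lattice `R
  -- B ℤ^d`.
  set N : Matrix (Fin d) (Fin d) ℝ := R • Bᵀ with hN
  set M : Matrix (Fin d) (Fin d) ℝ := N⁻¹ with hM
  have hNdet : N.det = R ^ d * B.det := by
    rw [hN, Matrix.det_smul, Matrix.det_transpose, Fintype.card_fin]
  have hNdet0 : N.det ≠ 0 := by
    rw [hNdet]
    exact mul_ne_zero (pow_ne_zero _ hRpos.ne') hBdet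
  have hMN : M * N = 1 := Matrix.nonsing_inv_mul _ (isUnit_iff_ne_zero.2 hNdet0)
  have hMdet : |M.det| = (R ^ d)⁻¹ * |B.det|⁻¹ := by
    rw [hM, Matrix.det_nonsing_inv, Ring.inverse_eq_inv', hNdet, abs_inv, abs_mul,
      abs_of_pos (pow_pos hRpos d), mul_inv]
  have hNt : ∀ k : Fin d → ℤ, Nᵀ *ᵥ intVec k = R • B.mulVec fun i => (k i : ℝ) := by
    intro k
    rw [hN, Matrix.transpose_smul, Matrix.transpose_transpose, Matrix.smul_mulVec]
    rfl
  have hNrow : ∀ i, ∑ j, |N i j| ≤ b * R := by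
    intro i
    simp only [hN, Matrix.smul_apply, Matrix.transpose_apply, smul_eq_mul, abs_mul,
      abs_of_pos hRpos]
    rw [← Finset.mul_sum, mul_comm]
    exact mul_le_mul_of_nonneg_right (hbi i) hRpos.le
  have hcount : ∀ t, {m | M *ᵥ (t + intVec m) ∈ unitCube d}.Finite ∧
      ({m | M *ᵥ (t + intVec m) ∈ unitCube d}.ncard : ℝ) ≤ ((2 * b + 1) * R) ^ d := by
    intro t
    obtain ⟨h1, h2⟩ := ncard_lattice_unitCube_le hMN (by positivity) hNrow t
    refine ⟨h1, h2.trans ?_⟩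
    gcongr
    linarith
  obtain ⟨hfin, hcard⟩ := hcount 0
  simp only [zero_add] at hfin hcard
  have hcardn : hfin.toFinset.card ≤ n := by
    rw [← Set.ncard_eq_toFinset_card _ hfin]
    exact_mod_cast hcard.trans hn
  obtain ⟨Q, hQ⟩ := exists_cubature_of_finset hfin.toFinset hcardn
    (fun m => X.cubeMap 1 (M *ᵥ intVec m)) (fun m _ => X.cubeMap_one_mem_unitCube hs _)
    (fun m => |M.det| * ∏ i, X.density ((M *ᵥ intVec m) i))
  refine ⟨Q, fun f hf => ?_⟩
  rw [hQ]
  have hlog : 0 ≤ Real.log R := Real.log_nonneg hR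
  have hsumR := hsum R hR
  simp only [← hNt] at hsumR
  refine (sq_lattice_error_le hs X hMN hf.1 hfin.toFinset (fun m hm => hfin.mem_toFinset.2 hm)
    (by positivity) hsumR (hK M N hMN _ hcount f hf)).trans (le_of_eq ?_)
  have hMpos : |M.det| ≠ 0 := by
    rw [hMdet]
    positivity
  have hRd : R ^ d ≠ 0 := (pow_pos hRpos d).ne'
  -- The node count contributes `R^d` and the remaining factor `|det M|` contributes `R^(-d)`; they
  -- cancel and leave the decay of the dual sum.
  calc _ = |M.det| * (|M.det| * |M.det|⁻¹) * (C * (R ^ (2 * s * d))⁻¹ *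
        (1 + Real.log R) ^ (d - 1)) * (((2 * b + 1) * R) ^ d * K) := by ring
    _ = _ := by
      rw [mul_inv_cancel₀ hMpos, hMdet, mul_pow]
      field_simp

/-- Cubature formulas with `n` nodes of optimal order. -/
theorem exists_cubature_abs_error_le {d s : ℕ} (hd : 1 ≤ d) (hs : 1 ≤ s) :
    ∃ C : ℝ, 0 < C ∧ ∀ n : ℕ, 1 ≤ n → (2 ≤ n ∨ d = 1) →
      ∃ Q : Cubature d n, ∀ f ∈ mixClass d s, |∫ x, f x ∂(cubeMeasure d) - Q.apply f| ≤
        C * (n : ℝ) ^ (-(s : ℝ)) * Real.log n ^ (((d : ℝ) - 1) / 2) := by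
  obtain ⟨L, C, hL, hC, hQ⟩ := exists_cubature_sq_error_le hd hs
  have hLpos : 0 < L := by linarith
  -- The 4 covers the squared bound `2^2` for small `n`, `L^(2sd)` comes from expressing `R` through
  -- `n`, and `3^(d-1)` from `1 + log n ≤ 3 log n` for `n ≥ 2`. For `d = 1` the logarithm has
  -- exponent 0.
  set D : ℝ := (C + 4) * L ^ (2 * s * d) * 3 ^ (d - 1) with hD
  have hDpos : 0 < D := by positivity
  refine ⟨Real.sqrt D, Real.sqrt_pos.2 hDpos, ?_⟩
  intro n hn hn2
  have hn1 : (1 : ℝ) ≤ n := by exact_mod_cast hn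
  have hnpos : (0 : ℝ) < n := by linarith
  have hlog : 0 ≤ Real.log n := Real.log_nonneg hn1
  have hlog3 : (1 + Real.log n) ^ (d - 1) ≤ 3 ^ (d - 1) * Real.log n ^ (d - 1) := by
    rcases hn2 with h2 | h1
    · rw [← mul_pow]
      have h3 : Real.log 2 ≤ Real.log n :=
        Real.log_le_log two_pos (by exact_mod_cast h2)
      have h4 := Real.log_two_gt_d9
      gcongr
      linarith
    · simp [h1]
  have hsq : (Real.sqrt D * (n : ℝ) ^ (-(s : ℝ)) * Real.log n ^ (((d : ℝ) - 1) / 2)) ^ 2 =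
      D * ((n : ℝ) ^ (2 * s))⁻¹ * Real.log n ^ (d - 1) := by
    have h1 : ((n : ℝ) ^ (-(s : ℝ))) ^ 2 = ((n : ℝ) ^ (2 * s))⁻¹ := by
      rw [Real.rpow_neg hnpos.le, Real.rpow_natCast, inv_pow, ← pow_mul, mul_comm s 2]
    have h2 : (Real.log n ^ (((d : ℝ) - 1) / 2)) ^ 2 = Real.log n ^ (d - 1) := by
      rw [← Real.rpow_natCast (Real.log n ^ _), ← Real.rpow_mul hlog, ← Real.rpow_natCast,
        Nat.cast_sub hd]
      congr 1
      push_cast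
      ring
    rw [mul_pow, mul_pow, Real.sq_sqrt hDpos.le, h1, h2]
  have hrate0 : 0 ≤ Real.sqrt D * (n : ℝ) ^ (-(s : ℝ)) * Real.log n ^ (((d : ℝ) - 1) / 2) := by
    positivity
  suffices h : ∃ Q : Cubature d n, ∀ f ∈ mixClass d s,
      (∫ x, f x ∂(cubeMeasure d) - Q.apply f) ^ 2 ≤
        (C + 4) * L ^ (2 * s * d) * ((n : ℝ) ^ (2 * s))⁻¹ * (1 + Real.log n) ^ (d - 1) by
    obtain ⟨Q, hQf⟩ := h
    refine ⟨Q, fun f hf => abs_le_of_sq_le_sq ?_ hrate0⟩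
    rw [hsq]
    refine (hQf f hf).trans ?_
    calc (C + 4) * L ^ (2 * s * d) * ((n : ℝ) ^ (2 * s))⁻¹ * (1 + Real.log n) ^ (d - 1)
        ≤ (C + 4) * L ^ (2 * s * d) * ((n : ℝ) ^ (2 * s))⁻¹ *
          (3 ^ (d - 1) * Real.log n ^ (d - 1)) := by gcongr
      _ = _ := by rw [hD]; ring
  have hd0 : d ≠ 0 := by omega
  rcases le_or_gt (L ^ d) n with hnL | hnL
  -- The largest `R` allowed by the node budget, with `(L R)^d = n`.
  · set R : ℝ := (n : ℝ) ^ ((d : ℝ)⁻¹) / L with hR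
    have hroot : ((n : ℝ) ^ ((d : ℝ)⁻¹)) ^ d = n := Real.rpow_inv_natCast_pow hnpos.le hd0
    have hroot0 : 0 ≤ (n : ℝ) ^ ((d : ℝ)⁻¹) := by positivity
    have hR1 : 1 ≤ R := by
      rw [hR, one_le_div hLpos, ← pow_le_pow_iff_left₀ hLpos.le hroot0 hd0, hroot]
      exact hnL
    have hLR : L * R = (n : ℝ) ^ ((d : ℝ)⁻¹) := by rw [hR]; field_simp
    obtain ⟨Q, hQf⟩ := hQ n R hR1 (by rw [hLR, hroot])
    refine ⟨Q, fun f hf => (hQf f hf).trans ?_⟩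
    have hRn : R ≤ n := by
      calc R ≤ R ^ d := le_self_pow₀ hR1 hd0
        _ ≤ (L * R) ^ d := by
          gcongr
          exact le_mul_of_one_le_left (by linarith) hL
        _ = n := by rw [hLR, hroot]
    have hRpow : R ^ (2 * s * d) = n ^ (2 * s) / L ^ (2 * s * d) := by
      rw [hR, div_pow, mul_comm (2 * s) d, pow_mul, hroot]
    have hlogR : 0 ≤ Real.log R := Real.log_nonneg hR1
    have hlogRn : Real.log R ≤ Real.log n := Real.log_le_log (by linarith) hRn
    calc C * (R ^ (2 * s * d))⁻¹ * (1 + Real.log R) ^ (d - 1)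
        ≤ (C + 4) * (R ^ (2 * s * d))⁻¹ * (1 + Real.log n) ^ (d - 1) := by
          gcongr
          linarith
      _ = _ := by rw [hRpow, inv_div]; ring
  -- For `n < L^d` no `R ≥ 1` is available, but the claimed bound is then at least 4 and the zero
  -- formula suffices.
  · obtain ⟨Q, hQ0⟩ := exists_cubature_of_finset (∅ : Finset (Fin d → ℤ)) (Nat.zero_le n)
      (fun _ => (0 : Fin d → ℝ)) (by simp) (fun _ => 0)
    refine ⟨Q, fun f hf => ?_⟩
    rw [hQ0, Finset.sum_empty, sub_zero, ← sq_abs]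
    have h1 := abs_integral_le_two hf
    have h2 : 1 ≤ L ^ (2 * s * d) * ((n : ℝ) ^ (2 * s))⁻¹ := by
      rw [← div_eq_mul_inv, one_le_div (by positivity), mul_comm (2 * s) d, pow_mul L d (2 * s)]
      exact pow_le_pow_left₀ hnpos.le hnL.le _
    have h3 : 1 ≤ (1 + Real.log n) ^ (d - 1) := one_le_pow₀ (by linarith)
    calc |∫ x, f x ∂(cubeMeasure d)| ^ 2 ≤ 2 ^ 2 := by gcongr
      _ ≤ (C + 4) * 1 * 1 := by linarith
      _ ≤ (C + 4) * (L ^ (2 * s * d) * ((n : ℝ) ^ (2 * s))⁻¹) * (1 + Real.log n) ^ (d - 1) := by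
        gcongr
      _ = _ := by ring

theorem corollary1 (s d : ℕ) (hs : 1 ≤ s) (hd : 1 ≤ d) :
    ∃ C : ℝ, 0 < C ∧ ∃ Q : (n : ℕ) → Cubature d n,
      ∀ n : ℕ, 1 ≤ n → (2 ≤ n ∨ d = 1) →
        (Q n).worstCaseError (mixClass d s) ≤
          ENNReal.ofReal (C * (n : ℝ) ^ (-(s : ℝ)) * Real.log n ^ (((d : ℝ) - 1) / 2)) := by
  obtain ⟨C, hC, h⟩ := exists_cubature_abs_error_le hd hs
  refine ⟨C, hC, ?_⟩
  classical
  have hex : ∀ n : ℕ, ∃ Q : Cubature d n, 1 ≤ n → (2 ≤ n ∨ d = 1) → ∀ f ∈ mixClass d s,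
      |∫ x, f x ∂(cubeMeasure d) - Q.apply f| ≤
        C * (n : ℝ) ^ (-(s : ℝ)) * Real.log n ^ (((d : ℝ) - 1) / 2) := by
    intro n
    by_cases hn : 1 ≤ n ∧ (2 ≤ n ∨ d = 1)
    · obtain ⟨Q, hQ⟩ := h n hn.1 hn.2
      exact ⟨Q, fun _ _ => hQ⟩
    -- An arbitrary formula for the values of `n` about which nothing is claimed.
    · exact ⟨⟨fun _ => 0, fun _ => ⟨le_rfl, zero_le_one⟩, fun _ => 0⟩,
        fun h1 h2 => absurd ⟨h1, h2⟩ hn⟩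
  choose Q hQ using hex
  refine ⟨Q, fun n hn hn2 => ?_⟩
  exact iSup₂_le fun f hf => ENNReal.ofReal_le_ofReal (hQ n hn hn2 f hf)
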